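/- Let $m\ge 1$ be odd, let $d\ge 1$, let $R=\sum_{i=0}^d a_i x^{2^i}\in\mathbb F_{2^m}[x]$ with $a_d\ne 0$, and put $f(x)=xR(x)$. For $n\ge 1$ set \[ S_n(f)=\sum_{x\in\mathbb F_{2^{mn}}}(-1)^{\mathrm{Tr}_{\mathbb F_{2^{mn}}/\mathbb F_2}(f(x))},\qquad S_n^*(f)=(\sqrt2)^{-mn}S_n(f), \] \[ L(f,T)=\exp\Big(\sum_{n\ge1}S_n(f)\frac{T^n}{n}\Big),\qquad L^*(f,T)=L\big(f,T/\sqrt2^{\,m}\big). \] Let $N$ be the degree over $\mathbb F_{2^m}$ of the splitting field of the kernel polynomial $\widetilde R=\sum_{i=0}^d\big(a_i^{2^d}x^{2^{d+i}}+a_i^{2^{d-i}}x^{2^{d-i}}\big)$, and write $N=2^aN'$ with $N'$ odd. Let $v_2$ be the $2$-adic valuation, let $\chi$ be the Dirichlet character modulo $8$ with $\chi(3)=\chi(5)=-1$ (and $\chi(7)=1$), let $\zeta_\ell=e^{2i\pi/\ell}$, and put \[ \Phi_\ell(T)=\prod_{i\in(\mathbb Z/\ell\mathbb Z)^\times}(1-\zeta_\ell^iT),\qquad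 \Phi_\ell^{\pm}(T)=\prod_{i\in(\mathbb Z/\ell\mathbb Z)^\times,\ \chi(i)=\pm1}(1-\zeta_\ell^iT)\quad(8\mid\ell). \] Then $L^*(f,T)$ is a polynomial that factors as \[ L^*(f,T)=\prod_{v_2(\ell)\le2}\Phi_\ell(T)^{m_\ell(f)}\prod_{v_2(\ell)\ge3}\Phi_\ell^+(T)^{m_\ell^+(f)}\Phi_\ell^-(T)^{m_\ell^-(f)} \] with nonnegative integer exponents, almost all zero. Define the negative multiplicities by $M_\ell^-(f)=0$ if $v_2(\ell)\le2$ and $M_\ell^-(f)=\frac{m_\ell^+(f)-m_\ell^-(f)}2$ if $v_2(\ell)\ge3$. Then: (1) $M_\ell^-(f)=0$ for every $\ell\ge1$ with $v_2(\ell)\ne3$; (2) every $\ell$ with $M_\ell^-(f)\neq0$ is of the form $8\ell'$ with $\ell'\mid N'$, and the multiplicities $M_{8\ell'}^-(f)$, $\ell'\mid N'$, satisfy the system \[ 2\sqrt2\,\Delta(N')A(N')\Delta(N')\,\big(M_{8\ell'}^-(f)\big)_{\ell'\mid N'}=\big(-S_n^*(f)\big)_{n\mid N'}, \] where $A(N')=(c_\ell(n))_{n,\ell\mid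 N'}$ (rows $n$, columns $\ell$) is the matrix of Ramanujan sums $c_\ell(n)=\sum_{i\in(\mathbb Z/\ell\mathbb Z)^\times}\zeta_\ell^{ni}$, and $\Delta(N')$ is the diagonal matrix with entries $\chi(\ell)$, $\ell\mid N'$. -/

import Mathlib

open Polynomial

noncomputable section

namespace QuadAS

/-! ### Roots of unity, cyclotomic factors, and the arithmetic matrices -/

/-- `ζ_ℓ = exp(2πi/ℓ)`. -/
def zeta (l : ℕ) : ℂ := Complex.exp (2 * Real.pi * Complex.I / l)

/-- Representatives `0 ≤ i < ℓ` of the units of `ℤ/ℓℤ`. -/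
def unitReps (l : ℕ) : Finset ℕ := (Finset.range l).filter fun i => i.Coprime l

/-- The character `χ` modulo `8` with `χ(3) = χ(5) = -1` (so `χ(1) = χ(7) = 1`), on naturals. -/
def chi (k : ℕ) : ℤ := ZMod.χ₈ (k : ZMod 8)

/-- `Φ_ℓ(T) = ∏ (1 - ζ T)`, `ζ` running over the primitive `ℓ`-th roots of unity. -/
def Phi (l : ℕ) : ℂ[X] := ∏ i ∈ unitReps l, (1 - C (zeta l ^ i) * X)

/-- For `8 ∣ ℓ` and `s = 1` (resp. `s = -1`), the factor `Φ_ℓ^+` (resp. `Φ_ℓ^-`) of `Φ_ℓ`. -/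
def PhiSign (s : ℤ) (l : ℕ) : ℂ[X] :=
  ∏ i ∈ (unitReps l).filter (fun i => chi i = s), (1 - C (zeta l ^ i) * X)

/-- The Ramanujan sum `c_ℓ(n)`. -/
def ramanujanSum (l n : ℕ) : ℂ := ∑ i ∈ unitReps l, zeta l ^ (n * i)

/-- The matrix `A(n) = (c_ℓ(d))`, rows `d ∣ n`, columns `ℓ ∣ n`. -/
def matA (n : ℕ) : Matrix n.divisors n.divisors ℂ :=
  Matrix.of fun d l => ramanujanSum l d

/-- The diagonal matrix `Δ(n)` with entries `χ(ℓ)`, `ℓ ∣ n`. -/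
def matDelta (n : ℕ) : Matrix n.divisors n.divisors ℂ :=
  Matrix.diagonal fun l => (chi l : ℂ)

/-! ### The quadratic form, its exponential sums and `L`-functions -/

section Curve

variable {F : Type*} [Field F]

/-- The `2`-linearized polynomial `R = ∑_{i ≤ d} a_i x^{2^i}`. -/
def linPoly (d : ℕ) (a : ℕ → F) : F[X] :=
  ∑ i ∈ Finset.range (d + 1), C (a i) * X ^ (2 ^ i)

/-- `f(x) = x R(x)`. -/
def quadPoly (d : ℕ) (a : ℕ → F) : F[X] := X * linPoly d a

/-- The kernel polynomial
`R̃ = ∑_{i ≤ d} (a_i^{2^d} x^{2^{d+i}} + a_i^{2^{d-i}} x^{2^{d-i}})`. -/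
def kernelPoly (d : ℕ) (a : ℕ → F) : F[X] :=
  ∑ i ∈ Finset.range (d + 1),
    (C (a i ^ (2 ^ d)) * X ^ (2 ^ (d + i)) + C (a i ^ (2 ^ (d - i))) * X ^ (2 ^ (d - i)))

/-- The degree over `F` of the splitting (decomposition) field of the kernel polynomial. -/
def kernelDegree (d : ℕ) (a : ℕ → F) : ℕ :=
  Module.finrank F (kernelPoly d a).SplittingField

variable [Finite F] [CharP F 2]

open Classical in
/-- `S_n(f) = ∑_{x ∈ F_n} (-1)^{Tr_{F_n/𝔽₂} f(x)}`, where `F_n` is the extension of degree `n ≥ 1`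
of `F` (the value at `n = 0` is irrelevant and set to `0`). -/
def expSum (f : F[X]) (n : ℕ) : ℤ :=
  if h : n = 0 then 0 else
    haveI : NeZero n := ⟨h⟩
    letI : Fintype (FiniteField.Extension F 2 n) := Fintype.ofFinite _
    ∑ x : FiniteField.Extension F 2 n,
      (-1 : ℤ) ^ (Algebra.trace (ZMod 2) (FiniteField.Extension F 2 n) (aeval x f)).val

/-- `L(f,T) = exp(∑_{n ≥ 1} S_n(f) T^n / n)`. -/
def LFun (f : F[X]) : PowerSeries ℂ :=
  (PowerSeries.exp ℂ).subst
    (PowerSeries.mk fun n => if n = 0 then (0 : ℂ) else (expSum f n : ℂ) / n)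

/-- The modified `L`-function `L^*(f,T) = L(f, T / √2^m)`, where `|F| = 2^m`. -/
def LStar (m : ℕ) (f : F[X]) : PowerSeries ℂ :=
  PowerSeries.rescale ((((Real.sqrt 2 : ℝ) : ℂ) ^ m)⁻¹) (LFun f)

/-- The modified sum `S_n^*(f) = √2^{-mn} S_n(f)`, where `|F| = 2^m`. -/
def expSumStar (m : ℕ) (f : F[X]) (n : ℕ) : ℂ :=
  (expSum f n : ℂ) / ((Real.sqrt 2 : ℝ) : ℂ) ^ (m * n)

end Curve

/-! ### Multiplicities -/

/-- Exponents `m_ℓ` (used for `v₂(ℓ) ≤ 2`) and `m_ℓ^+`, `m_ℓ^-` (used for `v₂(ℓ) ≥ 3`). -/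
structure Multiplicities where
  m : ℕ →₀ ℕ
  mPlus : ℕ →₀ ℕ
  mMinus : ℕ →₀ ℕ

/-- The product
`∏_{v₂(ℓ) ≤ 2} Φ_ℓ^{m_ℓ} ∏_{v₂(ℓ) ≥ 3} (Φ_ℓ^+)^{m_ℓ^+} (Φ_ℓ^-)^{m_ℓ^-}`, over `ℓ ≥ 1`. -/
def Multiplicities.toPoly (M : Multiplicities) : ℂ[X] :=
  (∏ l ∈ M.m.support.filter (fun l => 1 ≤ l ∧ padicValNat 2 l ≤ 2), Phi l ^ M.m l) *
  (∏ l ∈ M.mPlus.support.filter (fun l => 1 ≤ l ∧ 3 ≤ padicValNat 2 l),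
    PhiSign 1 l ^ M.mPlus l) *
  (∏ l ∈ M.mMinus.support.filter (fun l => 1 ≤ l ∧ 3 ≤ padicValNat 2 l),
    PhiSign (-1) l ^ M.mMinus l)

/-- The negative multiplicity `M_ℓ^-`: it is `0` if `v₂(ℓ) ≤ 2`, and `(m_ℓ^+ - m_ℓ^-)/2` if
`v₂(ℓ) ≥ 3`. -/
def Multiplicities.neg (M : Multiplicities) (l : ℕ) : ℚ :=
  if padicValNat 2 l ≤ 2 then 0 else ((M.mPlus l : ℚ) - (M.mMinus l : ℚ)) / 2

/-- `M` is the system of multiplicities of `f`: it gives the factorization of `L^*(f,T)`. -/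
def IsMultiplicitiesOf {F : Type*} [Field F] [Finite F] [CharP F 2]
    (m : ℕ) (f : F[X]) (M : Multiplicities) : Prop :=
  LStar m f = (M.toPoly : PowerSeries ℂ)

end QuadAS

end

/-!
# Negative multiplicities of the `L`-function of `x R(x)` in characteristic two

Write `q = 2^m` and `S_n` for the exponential sums of `f = x R(x)`, and `Λ(g)` for the sign
`(-1)^{Tr(∑ f(r))}` attached to a monic polynomial `g` over `𝔽_q` with roots `r`.

*The `L`-function is a polynomial.* The function `Λ` is multiplicative, and in terms of
`A_k = ∑ Λ(g)`, over the monic `g` of degree `k`, the logarithmic derivative of the Euler product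
reads `k A_k = ∑_{j=1}^k S_j A_{k-j}` (`mul_lCoeff`); so `L(f,T) = ∑ A_k T^k` (`coeff_LFun`). Monic
polynomials are handled as multisets of points of an algebraic closure stable under Frobenius. By
Newton's identities, for `k > 2^d` adding `c X^{k-2^d-1}` to `g` adds `a_d c` to `∑ f(r)`, hence
`A_k = 0` (`lCoeff_eq_zero`). Therefore `L^*(f,T) = ∏ (1 - wT)` over a finite multiset of nonzero
eigenvalues `w`, and `S_n^* = -∑ w^n`.

*The eigenvalues are roots of unity, with a twisted Galois symmetry.* The map `x ↦ Tr(x R(x))` is a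
quadratic form whose radical is the space of zeros of the kernel polynomial, so `S_n` is zero or
`S_n²` is `q^n` times the order of the radical (`expSum_sq`). The sums `S_n^*` thus take finitely
many values, and this makes every `w` a root of unity (`exists_pow_eq_one_of_finite`). Since
`√2^{mn} S_n^*` is an integer and `m` is odd, the automorphism `ζ ↦ ζ^i` multiplies `S_n^*` by
`χ(i)^n`, and the multiset of eigenvalues is stable under `w ↦ χ(i) w^i` (`exists_eigenvalues`).
This symmetry is what allows the stated factorization: if `8 ∤ ℓ`, the primitive `ℓ`-th roots of
unity and their opposites have a common multiplicity; if `8 ∣ ℓ`, the multiplicity of `ζ_ℓ^i` is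
that of `χ(i) ζ_ℓ`. So `M_ℓ^-` is half the difference between the multiplicities of `ζ_ℓ` and
`-ζ_ℓ` (`IsTwistedStable.neg_eq`). It vanishes if `16 ∣ ℓ`, because then `-ζ_ℓ = ζ_ℓ^i` with
`χ(i) = 1`.

*The sums of odd order.* For an odd prime `p` the Frobenius of `𝔽_{q^n}` acts on `𝔽_{q^{np}}` with
orbits of length `1` or `p`, so `S_{np} ≡ S_n` modulo `p` (`expSum_mul_prime_modEq`). If the radical
is the same over both fields, the squares of the sums fix the ratio `S_{np}/S_n` up to sign, and
`2^{(p-1)/2} ≡ χ(p)` then gives `S_{np}^* = χ(p) S_n^*` (`expSumStar_mul_prime`). Hence for odd `n`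
the value `χ(n) S_n^*` depends only on `gcd(n, N')` (`chi_mul_expSumStar`), and the sequence `S_n^*`,
`n` odd, has period `8N'`.

*Conclusion.* The power sums of the asymmetry `μ(w) - μ(-w)` of the multiplicities are `-2 S_n^*` for
odd `n` and zero for even `n`. They have period `8N'`, so the asymmetry is supported on roots of
unity of order dividing `8N'`, in fact of order `8ℓ'` with `ℓ' ∣ N'`. Expanding `-2 S_n^*` over these
roots produces the twisted sums `∑ χ(i) ζ_{8ℓ'}^{ni}`, which split into a Gauss sum modulo `8` and a
Ramanujan sum, with value `2√2 χ(n) c_{ℓ'}(n) χ(ℓ')` (`sum_chi_zeta_eight_mul`): this is the linear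
system.
-/

noncomputable section

namespace QuadAS

/-! ### Exponential sums inside an algebraically closed field -/

section Basic

variable {K : Type*} [Field K]

/-- The absolute trace of the field with `2 ^ N` elements, as the polynomial map
`y ↦ ∑_{i < N} y^{2^i}` on a field of characteristic `2` containing it. -/
def absTr (N : ℕ) (y : K) : K := ∑ i ∈ Finset.range N, y ^ 2 ^ i

open Classical in
/-- The nontrivial additive character of `𝔽₂`, read on the values `0`, `1` in `K`. -/
def sgn (y : K) : ℤ := if y = 0 then 1 else -1

open Classical in
/-- The elements of `K` fixed by `x ↦ x^{2^N}`; in an algebraically closed field of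
characteristic `2`, this is the subfield with `2 ^ N` elements. -/
def frobSet (K : Type*) [Field K] (N : ℕ) : Finset K := ((X ^ 2 ^ N - X : K[X]).roots).toFinset

lemma mem_frobSet {N : ℕ} (hN : N ≠ 0) {x : K} : x ∈ frobSet K N ↔ x ^ 2 ^ N = x := by
  have h : (X ^ 2 ^ N - X : K[X]) ≠ 0 :=
    FiniteField.X_pow_card_pow_sub_X_ne_zero K hN Nat.one_lt_two
  simp [frobSet, mem_roots h, sub_eq_zero]

lemma card_frobSet [CharP K 2] [IsAlgClosed K] {N : ℕ} (hN : N ≠ 0) :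
    (frobSet K N).card = 2 ^ N := by
  classical
  have hs := galois_poly_separable (K := K) 2 (2 ^ N) (dvd_pow_self 2 hN)
  have := nodup_roots hs
  rw [frobSet, Multiset.toFinset_card_of_nodup (by convert! this),
    ← (IsAlgClosed.splits _).natDegree_eq_card_roots]
  exact FiniteField.X_pow_card_pow_sub_X_natDegree_eq K hN Nat.one_lt_two

lemma mem_frobSet_pow_mul {Q : ℕ} {x : K} (h : x ^ 2 ^ Q = x) (i : ℕ) : x ^ 2 ^ (Q * i) = x := by
  induction i with
  | zero => simp
  | succ i ih => rw [mul_add, mul_one, pow_add, pow_mul, ih, h]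

@[simp] lemma sgn_zero : sgn (0 : K) = 1 := by simp [sgn]

@[simp] lemma sgn_one : sgn (1 : K) = -1 := by simp [sgn]

lemma sgn_eq_or (y : K) : sgn y = 1 ∨ sgn y = -1 := by
  unfold sgn; split_ifs <;> simp

lemma sgn_sq (y : K) : sgn y * sgn y = 1 := by
  rcases sgn_eq_or y with h | h <;> simp [h]

lemma absTr_zero (N : ℕ) : absTr N (0 : K) = 0 := by
  simp [absTr]

/-- If `y` lies in the field with `2 ^ N` elements, its trace from the extension of degree `e` of that
field is `e` times its trace. -/
lemma absTr_mul {N : ℕ} {y : K} (hy : y ^ 2 ^ N = y) (e : ℕ) :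
    absTr (N * e) y = e * absTr N y := by
  induction e with
  | zero => simp [absTr]
  | succ e ih =>
    have : absTr (N * e + N) y = absTr (N * e) y + absTr N y := by
      simp only [absTr, Finset.sum_range_add]
      congr 1
      refine Finset.sum_congr rfl fun i _ => ?_
      rw [pow_add, pow_mul, mem_frobSet_pow_mul hy]
    rw [mul_add, mul_one, this, ih]
    push_cast; ring

variable [CharP K 2]

lemma absTr_add (N : ℕ) (x y : K) : absTr N (x + y) = absTr N x + absTr N y := by
  have : Fact (Nat.Prime 2) := ⟨Nat.prime_two⟩
  simp [absTr, add_pow_char_pow, Finset.sum_add_distrib]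

lemma absTr_sum {ι : Type*} (N : ℕ) (s : Finset ι) (g : ι → K) :
    absTr N (∑ i ∈ s, g i) = ∑ i ∈ s, absTr N (g i) := by
  classical
  induction s using Finset.induction_on with
  | empty => simp [absTr_zero]
  | insert a s ha ih => simp [ha, absTr_add, ih]

lemma absTr_eq_zero_or_one {N : ℕ} {y : K} (hy : y ^ 2 ^ N = y) :
    absTr N y = 0 ∨ absTr N y = 1 := by
  have : Fact (Nat.Prime 2) := ⟨Nat.prime_two⟩
  have h : absTr N y ^ 2 = absTr N y := by
    have h1 : absTr N y ^ 2 = ∑ i ∈ Finset.range N, y ^ 2 ^ (i + 1) := by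
      rw [absTr, sum_pow_char]
      exact Finset.sum_congr rfl fun i _ => by rw [← pow_mul, pow_succ]
    have h2 := Finset.sum_range_succ' (fun i => y ^ 2 ^ i) N
    rw [Finset.sum_range_succ, hy] at h2
    rw [h1]
    simpa [absTr] using h2.symm
  have : absTr N y * (absTr N y - 1) = 0 := by rw [mul_sub, ← sq, h]; ring
  rcases mul_eq_zero.1 this with h | h
  · exact Or.inl h
  · exact Or.inr (sub_eq_zero.1 h)

lemma sgn_add {a b : K} (ha : a = 0 ∨ a = 1) (hb : b = 0 ∨ b = 1) :
    sgn (a + b) = sgn a * sgn b := by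
  rcases ha with rfl | rfl <;> rcases hb with rfl | rfl <;> simp [CharTwo.add_self_eq_zero]

lemma sgn_absTr_add {N : ℕ} {x y : K} (hx : x ^ 2 ^ N = x) (hy : y ^ 2 ^ N = y) :
    sgn (absTr N (x + y)) = sgn (absTr N x) * sgn (absTr N y) := by
  rw [absTr_add, sgn_add (absTr_eq_zero_or_one hx) (absTr_eq_zero_or_one hy)]

end Basic

section Field

/-- The sign `(-1)^{Tr y}` of Mathlib's trace to `𝔽₂`, computed by `absTr` after an embedding `g`. -/
lemma neg_one_pow_val_trace {E : Type*} [Field E] [Finite E] [Algebra (ZMod 2) E]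
    {K : Type*} [Field K] (g : E →+* K) (y : E) :
    (-1 : ℤ) ^ (Algebra.trace (ZMod 2) E y).val =
      sgn (absTr (Module.finrank (ZMod 2) E) (g y)) := by
  have h1 : g (algebraMap (ZMod 2) E (Algebra.trace (ZMod 2) E y)) =
      absTr (Module.finrank (ZMod 2) E) (g y) := by
    rw [FiniteField.algebraMap_trace_eq_sum_pow]
    simp [absTr]
  rw [← h1]
  generalize Algebra.trace (ZMod 2) E y = t
  have : t = 0 ∨ t = 1 := by revert t; decide
  rcases this with rfl | rfl
  · simp
  · simp [ZMod.val_one]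

variable {F : Type*} [Field F] [Finite F] {K : Type*} [Field K]

/-- A field with `2 ^ N` elements embedded in an algebraically closed field has image `frobSet K N`. -/
lemma image_frobSet [DecidableEq K] [CharP K 2] [IsAlgClosed K] {N : ℕ} (hN : N ≠ 0)
    {E : Type*} [Field E]
    [Fintype E] (hE : Fintype.card E = 2 ^ N) (g : E →+* K) :
    Finset.univ.image g = frobSet K N := by
  refine Finset.eq_of_subset_of_card_le ?_ ?_
  · intro y hy
    obtain ⟨x, -, rfl⟩ := Finset.mem_image.1 hy
    rw [mem_frobSet hN, ← map_pow, ← hE, FiniteField.pow_card]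
  · rw [Finset.card_image_of_injective _ g.injective, Finset.card_univ, hE, card_frobSet hN]

variable [Algebra F K]

lemma pow_natCard_algebraMap {m : ℕ} (hF : Nat.card F = 2 ^ m) (c : F) :
    (algebraMap F K c) ^ 2 ^ m = algebraMap F K c := by
  have := Fintype.ofFinite F
  rw [← hF, ← map_pow, Nat.card_eq_fintype_card, FiniteField.pow_card]

lemma ne_zero_of_natCard {m : ℕ} (hF : Nat.card F = 2 ^ m) : m ≠ 0 := by
  rintro rfl
  have : 1 < Nat.card F := Finite.one_lt_card
  omega

lemma charP_of_algebra (F K : Type*) [Field F] [CharP F 2] [Field K] [Algebra F K] :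
    CharP K 2 :=
  charP_of_injective_algebraMap (algebraMap F K).injective 2

lemma aeval_pow_frob [CharP K 2] {m : ℕ} (hF : Nat.card F = 2 ^ m) (f : F[X]) (x : K) :
    aeval x f ^ 2 ^ m = aeval (x ^ 2 ^ m) f := by
  have : Fact (Nat.Prime 2) := ⟨Nat.prime_two⟩
  induction f using Polynomial.induction_on' with
  | add p q hp hq => simp [add_pow_char_pow, hp, hq]
  | monomial n c =>
    simp only [aeval_monomial, mul_pow, pow_natCard_algebraMap hF]
    rw [← pow_mul, ← pow_mul, mul_comm n]

lemma aeval_pow_frob_mul [CharP K 2] {m : ℕ} (hF : Nat.card F = 2 ^ m) (f : F[X]) (x : K)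
    (n : ℕ) : aeval x f ^ 2 ^ (m * n) = aeval (x ^ 2 ^ (m * n)) f := by
  induction n with
  | zero => simp
  | succ n ih => rw [mul_add, mul_one, pow_add, pow_mul, ih, aeval_pow_frob hF, ← pow_mul]

variable [CharP F 2]

lemma finrank_extension_zmod {m : ℕ} (hF : Nat.card F = 2 ^ m) (n : ℕ) [NeZero n] :
    Module.finrank (ZMod 2) (FiniteField.Extension F 2 n) = m * n := by
  have h := FiniteField.natCard_extension F 2 n
  rw [hF, Module.natCard_eq_pow_finrank (K := ZMod 2), Nat.card_zmod, ← pow_mul] at h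
  exact Nat.pow_right_injective le_rfl h

variable [IsAlgClosed K]

lemma nonempty_extension_algHom (n : ℕ) [NeZero n] :
    Nonempty (FiniteField.Extension F 2 n →ₐ[F] K) :=
  ⟨IsAlgClosed.lift⟩

/-- The exponential sum over the abstract extension of degree `n`, computed on the points of an
algebraically closed field. -/
theorem expSum_eq [CharP K 2] {m : ℕ} (hF : Nat.card F = 2 ^ m) (f : F[X]) {n : ℕ} (hn : n ≠ 0) :
    expSum f n = ∑ x ∈ frobSet K (m * n), sgn (absTr (m * n) (aeval x f)) := by
  classical
  have : NeZero n := ⟨hn⟩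
  let : Fintype (FiniteField.Extension F 2 n) := Fintype.ofFinite _
  obtain ⟨g⟩ := nonempty_extension_algHom (F := F) (K := K) n
  have hN : m * n ≠ 0 := mul_ne_zero (ne_zero_of_natCard hF) hn
  have hE : Fintype.card (FiniteField.Extension F 2 n) = 2 ^ (m * n) := by
    rw [Fintype.card_eq_nat_card, FiniteField.natCard_extension, hF, pow_mul]
  rw [expSum, dif_neg hn, ← image_frobSet hN hE (g : FiniteField.Extension F 2 n →+* K),
    Finset.sum_image (fun x _ y _ h => (g : FiniteField.Extension F 2 n →+* K).injective h)]
  refine Finset.sum_congr rfl fun x _ => ?_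
  rw [neg_one_pow_val_trace (g : FiniteField.Extension F 2 n →+* K), finrank_extension_zmod hF]
  simp [aeval_algHom_apply]

end Field

/-! ### The square of the exponential sum of a quadratic form -/

section Square

/-- The trace to `𝔽₂` is invariant under the Frobenius. -/
lemma absTr_pow_two_pow {K : Type*} [Field K] [CharP K 2] {N : ℕ} {y : K}
    (hy : y ^ 2 ^ N = y) (k : ℕ) : absTr N (y ^ 2 ^ k) = absTr N y := by
  have : Fact (Nat.Prime 2) := ⟨Nat.prime_two⟩
  have h : absTr N (y ^ 2 ^ k) = absTr N y ^ 2 ^ k := by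
    rw [absTr, absTr, sum_pow_char_pow]
    exact Finset.sum_congr rfl fun i _ => by rw [← pow_mul, ← pow_mul, mul_comm]
  rw [h]
  rcases absTr_eq_zero_or_one hy with h | h <;> simp [h]

variable {E : Type*} [Field E] [Fintype E] [CharP E 2]

/-- The additive character `y ↦ (-1)^{Tr y}` of the field `E` with `2 ^ N` elements. -/
def traceChar {N : ℕ} (hE : Fintype.card E = 2 ^ N) : AddChar E ℤ where
  toFun y := sgn (absTr N y)
  map_zero_eq_one' := by simp [absTr_zero]
  map_add_eq_mul' x y := by
    apply sgn_absTr_add <;> rw [← hE, FiniteField.pow_card]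

lemma traceChar_apply {N : ℕ} (hE : Fintype.card E = 2 ^ N) (y : E) :
    traceChar hE y = sgn (absTr N y) := rfl

lemma traceChar_isPrimitive {N : ℕ} (hE : Fintype.card E = 2 ^ N) :
    (traceChar hE).IsPrimitive := by
  apply AddChar.IsPrimitive.of_ne_one
  let := ZMod.algebra E 2
  have hN : Module.finrank (ZMod 2) E = N := by
    have h := Module.natCard_eq_pow_finrank (K := ZMod 2) (V := E)
    rw [Nat.card_zmod, ← Fintype.card_eq_nat_card, hE] at h
    exact (Nat.pow_right_injective le_rfl h).symm
  obtain ⟨y, hy⟩ := Algebra.trace_surjective (ZMod 2) E 1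
  rw [AddChar.ne_one_iff]
  refine ⟨y, ?_⟩
  have h := neg_one_pow_val_trace (RingHom.id E) y
  rw [hy, hN] at h
  rw [traceChar_apply]
  simp only [RingHom.id_apply] at h
  rw [← h]
  decide

/-- If `φ(x + y) = φ(x) φ(y) ψ(x^{2^d} h(y))` with `φ = ±1`, `ψ` primitive and `h` additive, then
`(∑ φ)²` is `0` or `|E|` times the number of zeros of `h`. -/
lemma sum_sq_of_quadratic [DecidableEq E] (ψ : AddChar E ℤ) (hψ : ψ.IsPrimitive) (φ : E → ℤ)
    (hφ : ∀ x, φ x * φ x = 1) (h : E → E) (hadd : ∀ x y, h (x + y) = h x + h y) (d : ℕ)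
    (hq : ∀ x y, φ (x + y) = φ x * φ y * ψ (x ^ 2 ^ d * h y)) :
    (∑ x, φ x) ^ 2 = 0 ∨
      (∑ x, φ x) ^ 2 = Fintype.card E * (Finset.univ.filter fun z => h z = 0).card := by
  have : Fact (Nat.Prime 2) := ⟨Nat.prime_two⟩
  -- `x ↦ x^{2^d}` permutes `E`, so that `x^{2^d}` may be replaced by a free variable.
  have hbij : Function.Bijective fun x : E => x ^ 2 ^ d := by
    have := (iterateFrobeniusEquiv E 2 d).bijective
    convert! this using 1
  have key : (∑ x, φ x) ^ 2 =
      Fintype.card E * ∑ z ∈ Finset.univ.filter (fun z => h z = 0), φ z := by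
    calc (∑ x, φ x) ^ 2 = ∑ x, ∑ y, φ x * φ y := by rw [sq, Finset.sum_mul_sum]
      _ = ∑ x, ∑ z, φ x * φ (x + z) := by
          refine Finset.sum_congr rfl fun x _ => ?_
          exact (Equiv.sum_comp (Equiv.addLeft x) fun y => φ x * φ y).symm
      _ = ∑ z, ∑ x, φ z * ψ (x ^ 2 ^ d * h z) := by
          rw [Finset.sum_comm]
          refine Finset.sum_congr rfl fun z _ => Finset.sum_congr rfl fun x _ => ?_
          rw [hq, ← mul_assoc, ← mul_assoc, hφ, one_mul]
      _ = ∑ z, φ z * ∑ y, ψ (y * h z) := by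
          refine Finset.sum_congr rfl fun z _ => ?_
          rw [Finset.mul_sum]
          exact hbij.sum_comp fun y => φ z * ψ (y * h z)
      _ = ∑ z, if h z = 0 then Fintype.card E * φ z else 0 := by
          refine Finset.sum_congr rfl fun z _ => ?_
          rw [AddChar.sum_mulShift _ hψ]
          split_ifs <;> simp [mul_comm]
      _ = _ := by rw [← Finset.sum_filter, Finset.mul_sum]
  have hmul : ∀ x y, h y = 0 → φ (x + y) = φ x * φ y := fun x y hy => by
    rw [hq, hy, mul_zero, AddChar.map_zero_eq_one, mul_one]
  -- `φ` is a character of the kernel of `h`: its sum is the order of the kernel or zero.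
  by_cases hall : ∀ z, h z = 0 → φ z = 1
  · right
    rw [key, Finset.sum_congr rfl (fun z hz => hall z (Finset.mem_filter.1 hz).2)]
    simp
  · left
    push Not at hall
    obtain ⟨w, hw, hw1⟩ := hall
    have hz : ∑ z ∈ Finset.univ.filter (fun z => h z = 0), φ z = 0 := by
      have h1 : ∑ z ∈ Finset.univ.filter (fun z => h z = 0), φ z =
          ∑ z ∈ Finset.univ.filter (fun z => h z = 0), φ (z + w) := by
        simp only [Finset.sum_filter]
        rw [← Equiv.sum_comp (Equiv.addRight w)]
        refine Finset.sum_congr rfl fun z _ => ?_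
        simp [hadd, hw]
      rw [Finset.sum_congr rfl fun z _ => hmul z w hw, ← Finset.sum_mul] at h1
      have h2 : (∑ z ∈ Finset.univ.filter (fun z => h z = 0), φ z) * (φ w - 1) = 0 := by
        linear_combination -h1
      rcases mul_eq_zero.1 h2 with h3 | h3
      · exact h3
      · exact absurd (sub_eq_zero.1 h3) hw1
    rw [key, hz, mul_zero]

end Square

section Quad

variable {F : Type*} [Field F] (d : ℕ) (a : ℕ → F)

lemma aeval_linPoly {E : Type*} [Field E] [Algebra F E] (x : E) :
    aeval x (linPoly d a) = ∑ i ∈ Finset.range (d + 1), algebraMap F E (a i) * x ^ 2 ^ i := by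
  simp [linPoly]

lemma aeval_quadPoly {E : Type*} [Field E] [Algebra F E] (x : E) :
    aeval x (quadPoly d a) = x * aeval x (linPoly d a) := by
  simp [quadPoly]

lemma aeval_kernelPoly {E : Type*} [Field E] [Algebra F E] (x : E) :
    aeval x (kernelPoly d a) = ∑ i ∈ Finset.range (d + 1),
      (algebraMap F E (a i) ^ 2 ^ d * x ^ 2 ^ (d + i) +
        algebraMap F E (a i) ^ 2 ^ (d - i) * x ^ 2 ^ (d - i)) := by
  simp [kernelPoly]

variable {E : Type*} [Field E] [Algebra F E] [CharP E 2]

lemma aeval_linPoly_add (x y : E) :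
    aeval (x + y) (linPoly d a) = aeval x (linPoly d a) + aeval y (linPoly d a) := by
  have : Fact (Nat.Prime 2) := ⟨Nat.prime_two⟩
  simp only [aeval_linPoly, add_pow_char_pow, mul_add, Finset.sum_add_distrib]

lemma aeval_kernelPoly_add (x y : E) :
    aeval (x + y) (kernelPoly d a) = aeval x (kernelPoly d a) + aeval y (kernelPoly d a) := by
  have : Fact (Nat.Prime 2) := ⟨Nat.prime_two⟩
  simp only [aeval_kernelPoly, add_pow_char_pow, ← Finset.sum_add_distrib]
  exact Finset.sum_congr rfl fun i _ => by ring

/-- The polar form of `Tr(x R(x))` is `Tr(x^{2^d} R̃(y))`. -/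
lemma absTr_polar {N : ℕ} (hE : ∀ y : E, y ^ 2 ^ N = y) (x y : E) :
    absTr N (x * aeval y (linPoly d a) + y * aeval x (linPoly d a)) =
      absTr N (x ^ 2 ^ d * aeval y (kernelPoly d a)) := by
  simp only [aeval_linPoly, aeval_kernelPoly, Finset.mul_sum, ← Finset.sum_add_distrib, absTr_sum]
  refine Finset.sum_congr rfl fun i hi => ?_
  have hid : i + (d - i) = d := by have := Finset.mem_range.1 hi; omega
  rw [absTr_add, mul_add, absTr_add]
  congr 1
  · rw [← absTr_pow_two_pow (hE _) d]
    congr 1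
    simp only [mul_pow, ← pow_mul, ← pow_add]
    rw [add_comm i d]
  · rw [← absTr_pow_two_pow (hE _) (d - i)]
    congr 1
    simp only [mul_pow, ← pow_mul, ← pow_add]
    rw [hid]; ring

lemma quadPoly_sum_sq [Fintype E] [DecidableEq E] {N : ℕ} (hE : Fintype.card E = 2 ^ N) :
    (∑ x : E, sgn (absTr N (aeval x (quadPoly d a)))) ^ 2 = 0 ∨
    (∑ x : E, sgn (absTr N (aeval x (quadPoly d a)))) ^ 2 = Fintype.card E *
      (Finset.univ.filter fun z : E => aeval z (kernelPoly d a) = 0).card := by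
  have hfix : ∀ y : E, y ^ 2 ^ N = y := fun y => by rw [← hE, FiniteField.pow_card]
  refine sum_sq_of_quadratic (traceChar hE) (traceChar_isPrimitive hE) _ (fun x => sgn_sq _)
    (fun z => aeval z (kernelPoly d a)) (aeval_kernelPoly_add d a) d fun x y => ?_
  rw [traceChar_apply, ← absTr_polar d a hfix, ← sgn_absTr_add (hfix _) (hfix _),
    ← sgn_absTr_add (hfix _) (hfix _)]
  congr 2
  simp only [aeval_quadPoly, aeval_linPoly_add]
  ring

end Quad

section Sums

variable {F : Type*} [Field F] [Finite F] [CharP F 2]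
  {K : Type*} [Field K] [Algebra F K] [IsAlgClosed K]

open Classical in
/-- The radical of the quadratic form `Tr(x R(x))` on the field with `2 ^ N` elements: the zeros of
the kernel polynomial in that field. -/
def radical (K : Type*) [Field K] {F : Type*} [Field F] [Algebra F K] (d : ℕ) (a : ℕ → F) (N : ℕ) :
    Finset K :=
  (frobSet K N).filter fun z => aeval z (kernelPoly d a) = 0

/-- Besides the value of `S_n²`, this records that the radical is a subgroup of the additive
`2`-group, so that its order is a power of `2`. -/
theorem expSum_sq [CharP K 2] {m : ℕ} (hF : Nat.card F = 2 ^ m) (d : ℕ) (a : ℕ → F)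
    {n : ℕ} (hn : n ≠ 0) :
    (expSum (quadPoly d a) n = 0 ∨
      expSum (quadPoly d a) n ^ 2 = 2 ^ (m * n) * (radical K d a (m * n)).card) ∧
    (radical K d a (m * n)).card ∣ 2 ^ (m * n) := by
  classical
  have : NeZero n := ⟨hn⟩
  let : Fintype (FiniteField.Extension F 2 n) := Fintype.ofFinite _
  have : CharP (FiniteField.Extension F 2 n) 2 := charP_of_algebra F _
  obtain ⟨g⟩ := nonempty_extension_algHom (F := F) (K := K) n
  have hN : m * n ≠ 0 := mul_ne_zero (ne_zero_of_natCard hF) hn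
  have hE : Fintype.card (FiniteField.Extension F 2 n) = 2 ^ (m * n) := by
    rw [Fintype.card_eq_nat_card, FiniteField.natCard_extension, hF, pow_mul]
  have hsum : expSum (quadPoly d a) n = ∑ x : FiniteField.Extension F 2 n,
      sgn (absTr (m * n) (aeval x (quadPoly d a))) := by
    rw [expSum, dif_neg hn]
    refine Finset.sum_congr rfl fun x _ => ?_
    rw [neg_one_pow_val_trace (RingHom.id _), finrank_extension_zmod hF]
    rfl
  have hrad : (radical K d a (m * n)).card = (Finset.univ.filter
      fun z : FiniteField.Extension F 2 n => aeval z (kernelPoly d a) = 0).card := by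
    have hg := (g : FiniteField.Extension F 2 n →+* K).injective
    rw [radical, ← image_frobSet hN hE (g : FiniteField.Extension F 2 n →+* K),
      Finset.filter_image, Finset.card_image_of_injective _ hg]
    congr 1
    ext z
    simp [aeval_algHom_apply]
  rw [hrad, hsum]
  constructor
  · rcases quadPoly_sum_sq d a hE with h | h
    · exact Or.inl (pow_eq_zero_iff two_ne_zero |>.1 h)
    · right
      rw [h, hE]
      push_cast; rfl
  · let W : AddSubgroup (FiniteField.Extension F 2 n) :=
      (AddMonoidHom.mk' (fun z => aeval z (kernelPoly d a)) (aeval_kernelPoly_add d a)).ker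
    have := AddSubgroup.card_addSubgroup_dvd_card W
    rw [← Fintype.card_eq_nat_card (α := FiniteField.Extension F 2 n), hE] at this
    rwa [Nat.subtype_card (Finset.univ.filter
      fun z : FiniteField.Extension F 2 n => aeval z (kernelPoly d a) = 0)] at this
    simp [W, AddMonoidHom.mem_ker]

end Sums

/-! ### Comparison of the sums over extensions of odd degree -/

/-- A sum of signs that is invariant under a map of order dividing a prime `p` is congruent modulo `p`
to its part over the fixed points. -/
lemma sum_modEq_sum_fixedPoints {α : Type*} [Fintype α] [DecidableEq α] {p : ℕ} (hp : p.Prime)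
    (σ : α → α) (hσ : σ^[p] = id) (φ : α → ℤ) (hφ : ∀ x, φ x = 1 ∨ φ x = -1)
    (hinv : ∀ x, φ (σ x) = φ x) :
    ∑ x, φ x ≡ ∑ x ∈ Finset.univ.filter (fun x => σ x = x), φ x [ZMOD p] := by
  have : Fact p.Prime := ⟨hp⟩
  have hsum : ∀ s : Finset α,
      ∑ x ∈ s, φ x = 2 * ((s.filter fun x => φ x = 1).card : ℤ) - s.card := fun s => by
    have h : ∀ x, φ x = 2 * (if φ x = 1 then 1 else 0) - 1 := fun x => by
      rcases hφ x with h | h <;> simp [h]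
    rw [Finset.sum_congr rfl fun x _ => h x, Finset.sum_sub_distrib, ← Finset.mul_sum]
    simp
  have hcard : ∀ P : α → Prop, [DecidablePred P] → (∀ x, P x → P (σ x)) →
      ((Finset.univ.filter P).card : ℤ) ≡
        ((Finset.univ.filter fun x => σ x = x).filter P).card [ZMOD p] := fun P _ hP => by
    let τ : Function.End {x // P x} := fun x => ⟨σ x, hP x x.2⟩
    have hτi : ∀ (k : ℕ) (x : {x // P x}), ((τ ^ k) x : α) = σ^[k] x := fun k => by
      induction k with
      | zero => intro x; rfl
      | succ k ih =>
        intro x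
        rw [pow_succ, Function.iterate_succ_apply]
        exact ih (τ x)
    have hτ : τ ^ p ^ 1 = 1 := by
      funext x
      refine Subtype.ext ?_
      rw [hτi, pow_one, hσ]
      rfl
    have h := Equiv.Perm.card_fixedPoints_modEq hτ
    rw [Int.natCast_modEq_iff]
    convert! h using 1
    · rw [Fintype.card_subtype]
    · rw [Finset.filter_filter, ← Fintype.card_subtype]
      refine Fintype.card_congr
        { toFun := fun x => ⟨⟨x.1, x.2.2⟩, Subtype.ext x.2.1⟩
          invFun := fun x => ⟨x.1.1, congrArg Subtype.val x.2, x.1.2⟩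
          left_inv := fun _ => rfl
          right_inv := fun _ => rfl }
  rw [hsum, hsum]
  refine Int.ModEq.sub (Int.ModEq.mul_left _ ?_) ?_
  · exact hcard (fun x => φ x = 1) fun x hx => (hinv x).trans hx
  · have := hcard (fun _ => True) fun _ _ => trivial
    simpa using this

section Sums

variable {F : Type*} [Field F] [Finite F] [CharP F 2]

lemma natCast_eq_one_of_odd (K : Type*) [Field K] [CharP K 2] {p : ℕ} (hp : Odd p) :
    (p : K) = 1 := by
  obtain ⟨k, rfl⟩ := hp
  push_cast
  rw [CharTwo.two_eq_zero, zero_mul, zero_add]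

/-- The Frobenius of the field of degree `n` acts on the field of degree `np` with orbits of
length `1` or `p`. -/
theorem expSum_mul_prime_modEq {m : ℕ} (hF : Nat.card F = 2 ^ m) (f : F[X]) {n : ℕ} (hn : n ≠ 0)
    {p : ℕ} (hp : p.Prime) (hp2 : Odd p) :
    expSum f (n * p) ≡ expSum f n [ZMOD p] := by
  classical
  let K := AlgebraicClosure F
  have : CharP K 2 := charP_of_algebra F K
  have hm := ne_zero_of_natCard hF
  have hmn : m * n ≠ 0 := mul_ne_zero hm hn
  have hN : m * (n * p) ≠ 0 := mul_ne_zero hm (mul_ne_zero hn hp.ne_zero)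
  rw [expSum_eq (K := K) hF f (mul_ne_zero hn hp.ne_zero), expSum_eq (K := K) hF f hn]
  have hσmem : ∀ x ∈ frobSet K (m * (n * p)), x ^ 2 ^ (m * n) ∈ frobSet K (m * (n * p)) := by
    intro x hx
    rw [mem_frobSet hN] at hx ⊢
    rw [← pow_mul, mul_comm, pow_mul, hx]
  let σ : frobSet K (m * (n * p)) → frobSet K (m * (n * p)) :=
    fun x => ⟨x.1 ^ 2 ^ (m * n), hσmem x.1 x.2⟩
  have hσi : ∀ (k : ℕ) x, ((σ^[k] x : frobSet K (m * (n * p))) : K) = x.1 ^ 2 ^ (m * n * k) := by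
    intro k
    induction k with
    | zero => intro x; simp
    | succ k ih =>
      intro x
      rw [Function.iterate_succ_apply, ih]
      simp only [σ, ← pow_mul, ← pow_add]
      congr 2; ring
  have hσ : σ^[p] = id := by
    funext x
    refine Subtype.ext ?_
    rw [hσi, mul_assoc]
    exact (mem_frobSet hN).1 x.2
  have h := sum_modEq_sum_fixedPoints hp σ hσ
    (fun x => sgn (absTr (m * (n * p)) (aeval (x : K) f))) (fun x => sgn_eq_or _) (fun x => by
      have hx : aeval (x : K) f ^ 2 ^ (m * (n * p)) = aeval (x : K) f := by
        rw [aeval_pow_frob_mul hF, (mem_frobSet hN).1 x.2]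
      simp only [σ]
      rw [← aeval_pow_frob_mul hF, absTr_pow_two_pow hx])
  rw [Finset.sum_coe_sort (frobSet K (m * (n * p)))
    (fun x => sgn (absTr (m * (n * p)) (aeval x f)))] at h
  convert! h using 1
  refine Finset.sum_bij' (fun x hx => (⟨x, ?_⟩ : frobSet K (m * (n * p)))) (fun x _ => (x : K))
    ?_ ?_ ?_ ?_ ?_
  · rw [mem_frobSet hmn] at hx
    rw [mem_frobSet hN, ← mul_assoc, mem_frobSet_pow_mul hx]
  · intro x hx
    rw [mem_frobSet hmn] at hx
    simp only [Finset.mem_filter, Finset.mem_univ, true_and, σ]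
    exact Subtype.ext hx
  · intro x hx
    rw [mem_frobSet hmn]
    exact congrArg Subtype.val (Finset.mem_filter.1 hx).2
  · intro x hx; rfl
  · intro x hx; rfl
  · intro x hx
    have hx' : aeval x f ^ 2 ^ (m * n) = aeval x f := by
      rw [aeval_pow_frob_mul hF, (mem_frobSet hmn).1 hx]
    have h1 : absTr (m * (n * p)) (aeval x f) = absTr (m * n) (aeval x f) := by
      rw [← mul_assoc, absTr_mul hx', natCast_eq_one_of_odd K hp2, one_mul]
    rw [← h1]

/-- The coefficient of `x` in the kernel polynomial is `a_d`. -/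
lemma kernelPoly_ne_zero {F : Type*} [Field F] {d : ℕ} (hd : 1 ≤ d) {a : ℕ → F} (ha : a d ≠ 0) :
    kernelPoly d a ≠ 0 := by
  intro h
  have h1 := congrArg (fun p => coeff p 1) h
  simp only [kernelPoly, finsetSum_coeff, coeff_add, coeff_C_mul_X_pow, coeff_zero] at h1
  rw [Finset.sum_eq_single_of_mem d (by simp)] at h1
  · rw [if_neg, if_pos] at h1
    · simp [ha] at h1
    · simp
    · exact (Nat.one_lt_two_pow (by omega)).ne
  · intro i hi hid
    have := Finset.mem_range.1 hi
    rw [if_neg, if_neg, add_zero]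
    · exact (Nat.one_lt_two_pow (by omega)).ne
    · exact (Nat.one_lt_two_pow (by omega)).ne

section Radical

variable {K : Type*} [Field K] [Algebra F K] [IsAlgClosed K]

omit [CharP F 2] in
/-- The zeros of the kernel polynomial lie in the field of degree `kernelDegree d a` over `F`. -/
lemma pow_kernelDegree_of_root {m : ℕ} (hF : Nat.card F = 2 ^ m) {d : ℕ} (hd : 1 ≤ d)
    {a : ℕ → F} (ha : a d ≠ 0) {z : K} (hz : aeval z (kernelPoly d a) = 0) :
    z ^ 2 ^ (m * kernelDegree d a) = z := by
  let L := (kernelPoly d a).SplittingField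
  have : Finite L := Module.finite_of_finite F
  let := Fintype.ofFinite L
  let g : L →ₐ[F] K := IsAlgClosed.lift
  have hz' : (((kernelPoly d a).map (algebraMap F L)).map (g : L →+* K)).IsRoot z := by
    rw [map_map, AlgHom.comp_algebraMap, IsRoot.def, eval_map_algebraMap, hz]
  obtain ⟨y, rfl⟩ := (SplittingField.splits (kernelPoly d a)).mem_range_of_isRoot
    (Polynomial.map_ne_zero (kernelPoly_ne_zero hd ha)) hz'
  have hc : Fintype.card L = 2 ^ (m * kernelDegree d a) := by
    rw [Fintype.card_eq_nat_card, Module.natCard_eq_pow_finrank (K := F), hF, ← pow_mul]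
    rfl
  rw [← map_pow, ← hc, FiniteField.pow_card]

lemma iterate_pow_frob {K : Type*} [Field K] (m i : ℕ) (x : K) :
    (fun x : K => x ^ 2 ^ m)^[i] x = x ^ 2 ^ (m * i) := by
  induction i with
  | zero => simp
  | succ i ih => rw [Function.iterate_succ_apply', ih, ← pow_mul, ← pow_add, mul_add, mul_one]

lemma pow_two_pow_gcd {K : Type*} [Field K] {m n k : ℕ} {z : K} (hn : z ^ 2 ^ (m * n) = z)
    (hk : z ^ 2 ^ (m * k) = z) : z ^ 2 ^ (m * n.gcd k) = z := by
  rw [← iterate_pow_frob] at hn hk ⊢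
  exact Function.IsPeriodicPt.gcd hn hk

omit [CharP F 2] in
/-- The radical over the extension of degree `n` depends only on the gcd of `n` with the degree of the
splitting field of the kernel polynomial. -/
lemma radical_eq_gcd {m : ℕ} (hF : Nat.card F = 2 ^ m) {d : ℕ} (hd : 1 ≤ d)
    {a : ℕ → F} (ha : a d ≠ 0) {n : ℕ} (hn : n ≠ 0) :
    radical K d a (m * n) = radical K d a (m * n.gcd (kernelDegree d a)) := by
  have hm := ne_zero_of_natCard hF
  ext z
  simp only [radical, Finset.mem_filter]
  refine and_congr_left fun hz => ?_
  rw [mem_frobSet (mul_ne_zero hm hn), mem_frobSet (mul_ne_zero hm (Nat.gcd_ne_zero_left hn))]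
  refine ⟨fun h => pow_two_pow_gcd h (pow_kernelDegree_of_root hF hd ha hz), fun h => ?_⟩
  obtain ⟨c, hc⟩ := Nat.gcd_dvd_left n (kernelDegree d a)
  have := mem_frobSet_pow_mul h c
  rwa [mul_assoc, ← hc] at this

lemma card_radical_le {F : Type*} [Field F] {K : Type*} [Field K] [Algebra F K]
    {d : ℕ} (hd : 1 ≤ d) {a : ℕ → F} (ha : a d ≠ 0) (N : ℕ) :
    (radical K d a N).card ≤ (kernelPoly d a).natDegree := by
  classical
  have hne := kernelPoly_ne_zero hd ha
  calc (radical K d a N).card ≤ ((kernelPoly d a).aroots K).toFinset.card := by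
        refine Finset.card_le_card fun z hz => ?_
        rw [Multiset.mem_toFinset, mem_aroots]
        exact ⟨hne, (Finset.mem_filter.1 hz).2⟩
    _ ≤ ((kernelPoly d a).aroots K).card := Multiset.toFinset_card_le _
    _ ≤ ((kernelPoly d a).map (algebraMap F K)).natDegree := card_roots' _
    _ = _ := natDegree_map _

end Radical

lemma chi_mul (a b : ℕ) : chi (a * b) = chi a * chi b := by
  rw [chi, Nat.cast_mul, map_mul]; rfl

/-- If two integers with squares `2^t w` and `2^{tp} w` (or zero), `t` odd and `w ∣ 2^t`, are
congruent modulo an odd prime `p`, then the second is `χ(p) 2^{t(p-1)/2}` times the first: the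
squares give this up to sign, and `2^{(p-1)/2} ≡ χ(p)` modulo `p` gives the sign. -/
lemma eq_chi_mul_of_modEq {p t w : ℕ} (hp : p.Prime) (hp2 : Odd p) (ht : Odd t)
    (hw : w ∣ 2 ^ t) {s s' : ℤ} (hs : s = 0 ∨ s ^ 2 = 2 ^ t * w)
    (hs' : s' = 0 ∨ s' ^ 2 = 2 ^ (t * p) * w) (hmod : s' ≡ s [ZMOD p]) :
    s' = chi p * 2 ^ (t * (p / 2)) * s := by
  have : Fact p.Prime := ⟨hp⟩
  have hp3 : 2 < p := by
    have := hp.two_le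
    rcases this.lt_or_eq with h | h
    · exact h
    · rw [← h] at hp2; exact absurd hp2 (by decide)
  have hcop : ∀ k, ¬ (p : ℤ) ∣ 2 ^ k * w := fun k h => by
    have h1 : p ∣ 2 ^ k * w := by exact_mod_cast h
    have h2 : p ∣ 2 ^ (k + t) := h1.trans (by rw [pow_add]; exact mul_dvd_mul_left _ hw)
    have := Nat.le_of_dvd two_pos (hp.dvd_of_dvd_pow h2)
    omega
  have hpp : Prime (p : ℤ) := Nat.prime_iff_prime_int.1 hp
  rcases hs with rfl | hs
  · rcases hs' with rfl | hs'
    · simp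
    · exact absurd ((Int.modEq_zero_iff_dvd.1 hmod).trans
        ((dvd_pow_self s' two_ne_zero).trans hs'.dvd)) (hcop _)
  · have hps : ¬ (p : ℤ) ∣ s := fun h =>
      hcop t ((h.trans (dvd_pow_self s two_ne_zero)).trans hs.dvd)
    rcases hs' with rfl | hs'
    · exact absurd (Int.modEq_zero_iff_dvd.1 hmod.symm) hps
    · have hsq : s' ^ 2 = (2 ^ (t * (p / 2)) * s) ^ 2 := by
        obtain ⟨k, rfl⟩ := hp2
        rw [hs', mul_pow, hs, ← mul_assoc, ← pow_mul, ← pow_add]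
        congr 2
        have : (2 * k + 1) / 2 = k := by omega
        rw [this]; ring
      have hχ : ((chi p : ℤ) : ZMod p) = 2 ^ (p / 2) := by
        have h1 := legendreSym.eq_pow p 2
        rw [legendreSym.at_two (by omega)] at h1
        simpa [chi] using h1
      have hχ1 : chi p = 1 ∨ chi p = -1 := by
        have h1 := ZMod.χ₈_nat_eq_if_mod_eight p
        obtain ⟨k, rfl⟩ := hp2
        rw [chi, h1, if_neg (by omega)]
        split_ifs <;> simp
      have hs0 : (s : ZMod p) ≠ 0 := fun h => hps ((ZMod.intCast_zmod_eq_zero_iff_dvd s p).1 h)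
      have hmod' : (s' : ZMod p) = s := (ZMod.intCast_eq_intCast_iff s' s p).2 hmod
      -- The oddness of `t` enters here: `χ(p)^t = χ(p)`.
      have hpow : ((2 : ZMod p)) ^ (t * (p / 2)) = ((chi p : ℤ) : ZMod p) := by
        rw [mul_comm, pow_mul, ← hχ]
        rcases hχ1 with h | h <;> rw [h] <;> simp [ht.neg_one_pow]
      have h1ne : ((-1 : ZMod p)) ≠ 1 := by
        have : Fact (2 < p) := ⟨hp3⟩
        exact ZMod.neg_one_ne_one
      rcases sq_eq_sq_iff_eq_or_eq_neg.1 hsq with h | h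
      · rw [h] at hmod'
        push_cast at hmod'
        rw [hpow] at hmod'
        have h2 := mul_right_cancel₀ hs0 (hmod'.trans (one_mul _).symm)
        rcases hχ1 with h3 | h3
        · rw [h3, one_mul, h]
        · rw [h3] at h2; push_cast at h2; exact absurd h2 h1ne
      · rw [h] at hmod'
        push_cast at hmod'
        rw [hpow, ← neg_mul] at hmod'
        have h2 := mul_right_cancel₀ hs0 (hmod'.trans (one_mul _).symm)
        rcases hχ1 with h3 | h3
        · rw [h3] at h2; push_cast at h2; exact absurd h2 h1ne
        · rw [h3, h]; ring

lemma sqrt_two_sq : ((Real.sqrt 2 : ℝ) : ℂ) ^ 2 = 2 := by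
  rw [← Complex.ofReal_pow, Real.sq_sqrt (by norm_num)]; norm_num

lemma sqrt_two_ne_zero : ((Real.sqrt 2 : ℝ) : ℂ) ≠ 0 := by
  intro h
  have := sqrt_two_sq
  rw [h] at this; norm_num at this

/-- An extension of odd prime degree `p` that does not enlarge the radical multiplies the normalized
sum by `χ(p)`. -/
theorem expSumStar_mul_prime {m : ℕ} (hm : Odd m) (hF : Nat.card F = 2 ^ m) {d : ℕ} (hd : 1 ≤ d)
    {a : ℕ → F} (ha : a d ≠ 0) {n : ℕ} (hn : Odd n) {p : ℕ} (hp : p.Prime) (hp2 : Odd p)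
    (hg : (n * p).gcd (kernelDegree d a) = n.gcd (kernelDegree d a)) :
    expSumStar m (quadPoly d a) (n * p) = chi p * expSumStar m (quadPoly d a) n := by
  have : CharP (AlgebraicClosure F) 2 := charP_of_algebra F _
  have hn0 : n ≠ 0 := hn.pos.ne'
  have hnp : n * p ≠ 0 := mul_ne_zero hn0 hp.ne_zero
  obtain ⟨h1, hw⟩ := expSum_sq (K := AlgebraicClosure F) hF d a hn0
  obtain ⟨h2, -⟩ := expSum_sq (K := AlgebraicClosure F) hF d a hnp
  rw [radical_eq_gcd hF hd ha hnp, hg, ← radical_eq_gcd hF hd ha hn0, ← mul_assoc] at h2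
  have h3 := eq_chi_mul_of_modEq hp hp2 (hm.mul hn) hw h1 h2
    (expSum_mul_prime_modEq hF _ hn0 hp hp2)
  rw [expSumStar, expSumStar, h3]
  have h4 : ((Real.sqrt 2 : ℝ) : ℂ) ^ (m * (n * p)) =
      2 ^ (m * n * (p / 2)) * ((Real.sqrt 2 : ℝ) : ℂ) ^ (m * n) := by
    rw [← sqrt_two_sq, ← pow_mul, ← pow_add]
    congr 1
    obtain ⟨k, rfl⟩ := hp2
    have : (2 * k + 1) / 2 = k := by omega
    rw [this]; ring
  rw [h4]
  have h5 : ((Real.sqrt 2 : ℝ) : ℂ) ^ (m * n) ≠ 0 := pow_ne_zero _ sqrt_two_ne_zero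
  push_cast
  field_simp

lemma expSumStar_mul_of_gcd_eq {m : ℕ} (hm : Odd m) (hF : Nat.card F = 2 ^ m) {d : ℕ}
    (hd : 1 ≤ d) {a : ℕ → F} (ha : a d ≠ 0) (k : ℕ) (hk : Odd k) : ∀ n : ℕ, Odd n →
    (n * k).gcd (kernelDegree d a) = n.gcd (kernelDegree d a) →
    expSumStar m (quadPoly d a) (n * k) = chi k * expSumStar m (quadPoly d a) n := by
  induction k using Nat.recOnMul with
  | zero => simp at hk
  | one => intro n hn hg; simp [chi]
  | prime p hp => intro n hn hg; exact expSumStar_mul_prime hm hF hd ha hn hp hk hg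
  | mul k l ihk ihl =>
    intro n hn hg
    rw [Nat.odd_mul] at hk
    have h1 : (n * k).gcd (kernelDegree d a) = n.gcd (kernelDegree d a) := by
      apply Nat.dvd_antisymm
      · rw [← hg, ← mul_assoc]
        exact Nat.gcd_dvd_gcd_mul_right_left _ _ _
      · exact Nat.gcd_dvd_gcd_mul_right_left _ _ _
    rw [← mul_assoc] at hg ⊢
    rw [ihl hk.2 (n * k) (hn.mul hk.1) (hg.trans h1.symm), ihk hk.1 n hn h1, chi_mul]
    push_cast; ring

/-- For odd `n`, the modified sum `S_n^*` depends only on `gcd(n, N')`, up to the sign `χ(n)`. -/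
theorem chi_mul_expSumStar {m : ℕ} (hm : Odd m) (hF : Nat.card F = 2 ^ m) {d : ℕ}
    (hd : 1 ≤ d) {a : ℕ → F} (ha : a d ≠ 0) {s N' : ℕ} (hN : kernelDegree d a = 2 ^ s * N')
    {n : ℕ} (hn : Odd n) :
    chi n * expSumStar m (quadPoly d a) n =
      chi (n.gcd N') * expSumStar m (quadPoly d a) (n.gcd N') := by
  obtain ⟨k, hk⟩ := Nat.gcd_dvd_left n N'
  have hgcd : ∀ j : ℕ, Odd j → j.gcd (kernelDegree d a) = j.gcd N' := fun j hj => by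
    rw [hN, Nat.Coprime.gcd_mul_left_cancel_right]
    exact (Nat.coprime_two_left.2 hj).pow_left s
  have hodd : Odd (n.gcd N') ∧ Odd k := by
    rw [hk] at hn; exact Nat.odd_mul.1 hn
  have h := expSumStar_mul_of_gcd_eq hm hF hd ha k hodd.2 (n.gcd N') hodd.1 (by
    rw [← hk, hgcd n hn, hgcd _ hodd.1, Nat.gcd_assoc, Nat.gcd_self])
  rw [← hk] at h
  have hχ : chi n = chi (n.gcd N') * chi k := by
    conv_lhs => rw [hk]
    exact chi_mul _ _
  have hk1 : (chi k : ℂ) * chi k = 1 := by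
    have h1 := ZMod.χ₈_nat_eq_if_mod_eight k
    have : chi k * chi k = 1 := by
      have := Nat.odd_iff.1 hodd.2
      rw [chi, h1, if_neg (by omega)]
      split_ifs <;> simp
    exact_mod_cast this
  rw [h, hχ]
  push_cast
  linear_combination (chi (n.gcd N') * expSumStar m (quadPoly d a) (n.gcd N')) * hk1

end Sums

/-! ### Multisets stable under an injective map -/

section Orbits

variable {α : Type*} (φ : α → α)

/-- The first `j` points `x, φ(x), …, φ^{j-1}(x)` of the orbit of `x`, with multiplicities. -/
def orbitSeg (j : ℕ) (x : α) : Multiset α := (Multiset.range j).map fun i => φ^[i] x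

@[simp] lemma card_orbitSeg (j : ℕ) (x : α) : Multiset.card (orbitSeg φ j x) = j := by
  simp [orbitSeg]

variable {φ}

lemma map_orbitSeg {j : ℕ} {x : α} (h : φ^[j] x = x) :
    (orbitSeg φ j x).map φ = orbitSeg φ j x := by
  rcases j with _ | j
  · simp [orbitSeg]
  have h1 : (Multiset.range (j + 1)).map (fun i => φ^[i] x) =
      x ::ₘ (Multiset.range j).map fun i => φ^[i + 1] x := by
    have : List.range (j + 1) = 0 :: (List.range j).map Nat.succ := List.range_succ_eq_map
    rw [Multiset.range, this]
    simp [Multiset.range, Function.comp_def]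
  rw [orbitSeg, Multiset.map_map]
  conv_rhs => rw [h1]
  rw [Multiset.range_succ, Multiset.map_cons]
  have h2 : φ (φ^[j] x) = x := (Function.iterate_succ_apply' φ j x).symm.trans h
  rw [Function.comp_apply, h2]
  congr 1
  refine Multiset.map_congr rfl fun i _ => ?_
  exact (Function.iterate_succ_apply' φ i x).symm

lemma orbitSeg_mul {D : ℕ} {x : α} (h : φ^[D] x = x) (e : ℕ) :
    orbitSeg φ (e * D) x = e • orbitSeg φ D x := by
  have hper : ∀ k, φ^[D * k] x = x := fun k => by
    rw [Function.iterate_mul]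
    exact Function.iterate_fixed h k
  induction e with
  | zero => simp [orbitSeg]
  | succ e ih =>
    rw [add_mul, one_mul, add_smul, one_smul, ← ih, orbitSeg, orbitSeg, orbitSeg,
      Multiset.range_add_eq_union, ← Multiset.add_eq_union_iff_disjoint.2 ?_, Multiset.map_add,
      Multiset.map_map]
    · congr 1
      refine Multiset.map_congr rfl fun i _ => ?_
      rw [Function.comp_apply, add_comm, Function.iterate_add_apply, mul_comm, hper]
    · rw [Multiset.disjoint_left]
      intro i hi hi'
      obtain ⟨k, -, rfl⟩ := Multiset.mem_map.1 hi'
      have := Multiset.mem_range.1 hi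
      omega

variable [DecidableEq α]

lemma count_iterate (hφ : Function.Injective φ) {s : Multiset α} (hs : s.map φ = s) (x : α)
    (i : ℕ) : s.count (φ^[i] x) = s.count x := by
  induction i with
  | zero => rfl
  | succ i ih =>
    rw [Function.iterate_succ_apply', ← ih]
    conv_lhs => rw [← hs]
    exact Multiset.count_map_eq_count' _ _ hφ _

lemma exists_period_of_mem (hφ : Function.Injective φ) {s : Multiset α} (hs : s.map φ = s)
    {x : α} (hx : x ∈ s) : x ∈ Function.periodicPts φ := by
  have hmem : ∀ i, φ^[i] x ∈ s.toFinset := fun i => by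
    rw [Multiset.mem_toFinset, ← Multiset.count_pos, count_iterate hφ hs, Multiset.count_pos]
    exact hx
  obtain ⟨i, j, hij, h⟩ := Finite.exists_ne_map_eq_of_infinite
    (fun i => (⟨φ^[i] x, hmem i⟩ : s.toFinset))
  have h' : φ^[i] x = φ^[j] x := congrArg Subtype.val h
  wlog hlt : i < j generalizing i j
  · exact this j i hij.symm h.symm h'.symm (lt_of_le_of_ne (not_lt.1 hlt) hij.symm)
  refine Function.mk_mem_periodicPts (Nat.sub_pos_of_lt hlt) (hφ.iterate i ?_)
  rw [← Function.iterate_add_apply, Nat.add_sub_cancel' hlt.le, h']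

/-- In a stable multiset, the multiplicity of `x` is the number of closed orbit segments through
`x`, of any length, that the multiset contains. This is the multiset form of
`∑_{d ∣ n} Λ(d) = log n`. -/
theorem count_eq_card_orbitSeg (hφ : Function.Injective φ) {s : Multiset α} (hs : s.map φ = s)
    (x : α) : s.count x = ((Finset.Icc 1 (Multiset.card s)).filter
      fun j => φ^[j] x = x ∧ orbitSeg φ j x ≤ s).card := by
  by_cases hx : x ∈ s
  · have hper := exists_period_of_mem hφ hs hx
    set D := Function.minimalPeriod φ x with hD
    have hDpos : 0 < D := Function.minimalPeriod_pos_of_mem_periodicPts hper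
    have hDx : φ^[D] x = x := Function.iterate_minimalPeriod
    have hnodup : (orbitSeg φ D x).Nodup := by
      refine Multiset.Nodup.map_on ?_ (Multiset.nodup_range D)
      intro i hi j hj h
      exact Function.iterate_injOn_Iio_minimalPeriod (Multiset.mem_range.1 hi)
        (Multiset.mem_range.1 hj) h
    have hle : ∀ e, orbitSeg φ (e * D) x ≤ s ↔ e ≤ s.count x := by
      intro e
      rw [orbitSeg_mul hDx, Multiset.le_iff_count]
      constructor
      · intro h
        have h1 := h x
        rwa [Multiset.count_nsmul, Multiset.count_eq_one_of_mem hnodup, mul_one] at h1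
        exact Multiset.mem_map.2 ⟨0, Multiset.mem_range.2 hDpos, rfl⟩
      · intro h y
        rw [Multiset.count_nsmul]
        by_cases hy : y ∈ orbitSeg φ D x
        · rw [Multiset.count_eq_one_of_mem hnodup hy, mul_one]
          obtain ⟨i, -, rfl⟩ := Multiset.mem_map.1 hy
          rwa [count_iterate hφ hs]
        · rw [Multiset.count_eq_zero_of_notMem hy, mul_zero]
          exact Nat.zero_le _
    -- With `D` the minimal period, a closed segment has length `eD` and is `e` times the orbit of `x`.
    have : (Finset.Icc 1 (Multiset.card s)).filter (fun j => φ^[j] x = x ∧ orbitSeg φ j x ≤ s) =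
        (Finset.Icc 1 (s.count x)).image (fun e => e * D) := by
      ext j
      simp only [Finset.mem_filter, Finset.mem_Icc, Finset.mem_image]
      constructor
      · rintro ⟨⟨h1, -⟩, h2, h3⟩
        obtain ⟨e, rfl⟩ : D ∣ j := Function.IsPeriodicPt.minimalPeriod_dvd h2
        rw [mul_comm] at h1 h3
        exact ⟨e, ⟨Nat.pos_of_mul_pos_right h1, (hle e).1 h3⟩, mul_comm _ _⟩
      · rintro ⟨e, ⟨h1, h2⟩, rfl⟩
        have h3 := (hle e).2 h2
        refine ⟨⟨Nat.mul_pos h1 hDpos, ?_⟩, ?_, h3⟩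
        · simpa using Multiset.card_le_card h3
        · rw [mul_comm, Function.iterate_mul]
          exact Function.iterate_fixed hDx e
    rw [this, Finset.card_image_of_injective _ fun _ _ h => Nat.eq_of_mul_eq_mul_right hDpos h,
      Nat.card_Icc, Nat.add_sub_cancel]
  · rw [Multiset.count_eq_zero_of_notMem hx, eq_comm, Finset.card_eq_zero]
    refine Finset.filter_eq_empty_iff.2 fun j hj h => hx ?_
    exact Multiset.mem_of_le h.2
      (Multiset.mem_map.2 ⟨0, Multiset.mem_range.2 (Finset.mem_Icc.1 hj).1, rfl⟩)

end Orbits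

/-! ### Polynomials over the finite field and Frobenius-stable multisets -/

section Divisors

variable {F : Type*} [Field F] {K : Type*} [Field K] [Algebra F K]

lemma aroots_injective_of_monic [IsAlgClosed K] {g h : F[X]} (hg : g.Monic) (hh : h.Monic)
    (h' : g.aroots K = h.aroots K) : g = h := by
  refine Polynomial.map_injective _ (algebraMap F K).injective ?_
  rw [(IsAlgClosed.splits (g.map (algebraMap F K))).eq_prod_roots_of_monic (hg.map _),
    (IsAlgClosed.splits (h.map (algebraMap F K))).eq_prod_roots_of_monic (hh.map _)]
  exact congrArg _ (congrArg _ h')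

lemma card_aroots [IsAlgClosed K] (g : F[X]) : Multiset.card (g.aroots K) = g.natDegree := by
  rw [aroots, ← (IsAlgClosed.splits _).natDegree_eq_card_roots, natDegree_map]

variable [Finite F]

/-- The monic polynomials of degree `k` over `F`. -/
def monics (F : Type*) [Field F] (k : ℕ) : Set F[X] := {g | g.Monic ∧ g.natDegree = k}

lemma finite_monics (k : ℕ) : (monics F k).Finite := by
  refine Set.Finite.subset (Set.finite_range
    (fun c : Fin (k + 1) → F => ∑ i : Fin (k + 1), C (c i) * X ^ (i : ℕ))) ?_
  rintro g ⟨-, hg⟩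
  refine ⟨fun i => g.coeff i, ?_⟩
  conv_rhs => rw [g.as_sum_range_C_mul_X_pow, hg, Finset.sum_range]

/-- The multiset `s` is stable under `x ↦ x^{2^m}`: it is an effective divisor on the affine line
over the field with `2 ^ m` elements. -/
def IsFrobStable (m : ℕ) (s : Multiset K) : Prop := s.map (fun x => x ^ 2 ^ m) = s

lemma IsFrobStable.add {m : ℕ} {s t : Multiset K} (hs : IsFrobStable m s)
    (ht : IsFrobStable m t) : IsFrobStable m (s + t) := by
  rw [IsFrobStable, Multiset.map_add, hs, ht]

lemma IsFrobStable.of_add {m : ℕ} {s t : Multiset K} (hs : IsFrobStable m s)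
    (hst : IsFrobStable m (s + t)) : IsFrobStable m t := by
  rw [IsFrobStable, Multiset.map_add, hs] at hst
  exact add_left_cancel hst

variable [CharP K 2]

lemma pow_frob_injective (m : ℕ) : Function.Injective fun x : K => x ^ 2 ^ m := by
  have : Fact (Nat.Prime 2) := ⟨Nat.prime_two⟩
  exact (iterateFrobenius K 2 m).injective

/-- The multiplicative function `s ↦ (-1)^{Tr(∑_{r ∈ s} f(r))}` on Frobenius-stable multisets. -/
def divChar (m : ℕ) (f : F[X]) (s : Multiset K) : ℤ :=
  sgn (absTr m (s.map fun r => aeval r f).sum)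

lemma sum_aeval_pow_frob {m : ℕ} (hF : Nat.card F = 2 ^ m) (f : F[X]) {s : Multiset K}
    (hs : IsFrobStable m s) :
    (s.map fun r => aeval r f).sum ^ 2 ^ m = (s.map fun r => aeval r f).sum := by
  have : Fact (Nat.Prime 2) := ⟨Nat.prime_two⟩
  have h : (s.map fun r => aeval r f).sum ^ 2 ^ m = (s.map fun r => aeval r f ^ 2 ^ m).sum := by
    have := map_multiset_sum (iterateFrobenius K 2 m) (s.map fun r => aeval r f)
    simpa [Multiset.map_map, iterateFrobenius_def, Function.comp_def] using this
  rw [h]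
  conv_rhs => rw [← hs, Multiset.map_map]
  congr 1
  exact Multiset.map_congr rfl fun r _ => aeval_pow_frob hF f r

/-- For `x` in the extension of degree `j`, the sum of `f` over the orbit segment of length `j` is the
relative trace of `f(x)`, by transitivity of the trace. -/
lemma divChar_orbitSeg {m : ℕ} (hF : Nat.card F = 2 ^ m) (f : F[X]) (j : ℕ) (x : K) :
    divChar m f (orbitSeg (fun x => x ^ 2 ^ m) j x) = sgn (absTr (m * j) (aeval x f)) := by
  rw [divChar]
  congr 1
  have h1 : ((orbitSeg (fun x => x ^ 2 ^ m) j x).map fun r => aeval r f).sum =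
      ∑ i ∈ Finset.range j, aeval x f ^ 2 ^ (m * i) := by
    rw [orbitSeg, Multiset.map_map]
    refine congrArg Multiset.sum (Multiset.map_congr rfl fun i _ => ?_)
    rw [Function.comp_apply, iterate_pow_frob, aeval_pow_frob_mul hF]
  rw [h1, absTr_sum]
  clear h1
  generalize aeval x f = y
  induction j with
  | zero => simp [absTr]
  | succ j ih =>
    rw [Finset.sum_range_succ, ih, mul_add, mul_one, absTr, absTr, absTr,
      Finset.sum_range_add]
    congr 1
    refine Finset.sum_congr rfl fun i _ => ?_
    rw [← pow_mul, ← pow_add]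

lemma divChar_add {m : ℕ} (hF : Nat.card F = 2 ^ m) (f : F[X]) {s t : Multiset K}
    (hs : IsFrobStable m s) (ht : IsFrobStable m t) :
    divChar m f (s + t) = divChar m f s * divChar m f t := by
  rw [divChar, Multiset.map_add, Multiset.sum_add,
    sgn_absTr_add (sum_aeval_pow_frob hF f hs) (sum_aeval_pow_frob hF f ht)]
  rfl

variable [IsAlgClosed K]

lemma isFrobStable_aroots {m : ℕ} (hF : Nat.card F = 2 ^ m) (g : F[X]) :
    IsFrobStable m (g.aroots K) := by
  have : Fact (Nat.Prime 2) := ⟨Nat.prime_two⟩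
  have h := (IsAlgClosed.splits (g.map (algebraMap F K))).roots_map (iterateFrobenius K 2 m)
  rw [map_map] at h
  have h1 : (iterateFrobenius K 2 m).comp (algebraMap F K) = algebraMap F K := by
    ext c
    simpa [iterateFrobenius_def] using pow_natCard_algebraMap hF c
  rw [h1] at h
  exact h.symm

/-- Frobenius-stable multisets are the root multisets of monic polynomials over `F`. -/
lemma exists_aroots_eq {m : ℕ} (hF : Nat.card F = 2 ^ m) {s : Multiset K}
    (hs : IsFrobStable m s) : ∃ g : F[X], g.Monic ∧ g.aroots K = s := by
  classical
  have : Fact (Nat.Prime 2) := ⟨Nat.prime_two⟩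
  set G : K[X] := (s.map fun x => X - C x).prod with hG
  have hGm : G.Monic := monic_multiset_prod_of_monic _ _ fun x _ => monic_X_sub_C x
  have hfix : G.map (iterateFrobenius K 2 m) = G := by
    rw [hG, Polynomial.map_multiset_prod, Multiset.map_map]
    conv_rhs => rw [← hs, Multiset.map_map]
    congr 2
    funext x
    simp [iterateFrobenius_def]
  have hlift : G ∈ lifts (algebraMap F K) := by
    rw [lifts_iff_coeff_lifts]
    intro n
    have h1 : G.coeff n ∈ frobSet K m := by
      rw [mem_frobSet (ne_zero_of_natCard hF)]
      have := congrArg (fun p => coeff p n) hfix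
      simpa [iterateFrobenius_def] using this
    let := Fintype.ofFinite F
    rw [← image_frobSet (ne_zero_of_natCard hF) (by rw [Fintype.card_eq_nat_card, hF])
      (algebraMap F K)] at h1
    obtain ⟨c, -, hc⟩ := Finset.mem_image.1 h1
    exact ⟨c, hc⟩
  obtain ⟨g, hg, -, hgm⟩ := lifts_and_natDegree_eq_and_monic hlift hGm
  exact ⟨g, hgm, by rw [aroots, hg, hG, roots_multiset_prod_X_sub_C]⟩

open Classical in
/-- The Frobenius-stable multisets of `k` elements of `K`, that is, the effective divisors of
degree `k` on the affine line over `F`. -/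
def stableMultisets (F K : Type*) [Field F] [Finite F] [Field K] [Algebra F K] (k : ℕ) :
    Finset (Multiset K) :=
  (finite_monics (F := F) k).toFinset.image fun g => g.aroots K

lemma mem_stableMultisets {m : ℕ} (hF : Nat.card F = 2 ^ m) {k : ℕ} {s : Multiset K} :
    s ∈ stableMultisets F K k ↔ IsFrobStable m s ∧ Multiset.card s = k := by
  simp only [stableMultisets, Finset.mem_image, Set.Finite.mem_toFinset, monics, Set.mem_ofPred_eq]
  constructor
  · rintro ⟨g, ⟨-, hg⟩, rfl⟩
    exact ⟨isFrobStable_aroots hF g, by rw [card_aroots, hg]⟩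
  · rintro ⟨hs, hk⟩
    obtain ⟨g, hg, rfl⟩ := exists_aroots_eq hF hs
    exact ⟨g, ⟨hg, by rw [← hk, card_aroots]⟩, rfl⟩

/-! ### The coefficients of the `L`-function -/

/-- The `k`-th coefficient of the `L`-function, a sum over effective divisors of degree `k`. -/
def lCoeff (K : Type*) [Field K] [Algebra F K] (m : ℕ) (f : F[X]) (k : ℕ) : ℤ :=
  ∑ s ∈ stableMultisets F K k, divChar m f s

/-- Removing the divisor `t` from the divisors `s ≥ t` of degree `k` gives all those of degree
`k - j`. -/
lemma sum_divChar_of_le {m : ℕ} (hF : Nat.card F = 2 ^ m) (f : F[X]) {j k : ℕ} (hjk : j ≤ k)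
    {t : Multiset K} [DecidablePred fun s => t ≤ s] (ht : IsFrobStable m t)
    (htj : Multiset.card t = j) :
    ∑ s ∈ (stableMultisets F K k).filter (fun s => t ≤ s), divChar m f s =
      divChar m f t * lCoeff K m f (k - j) := by
  classical
  rw [lCoeff, Finset.mul_sum]
  refine Finset.sum_bij' (fun s _ => s - t) (fun u _ => t + u) ?_ ?_ ?_ ?_ ?_
  · intro s hs
    rw [Finset.mem_filter, mem_stableMultisets hF] at hs
    obtain ⟨⟨h1, h2⟩, h3⟩ := hs
    rw [mem_stableMultisets hF]
    refine ⟨ht.of_add ?_, by rw [Multiset.card_sub h3, h2, htj]⟩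
    rwa [add_comm, Multiset.sub_add_cancel h3]
  · intro u hu
    rw [mem_stableMultisets hF] at hu
    rw [Finset.mem_filter, mem_stableMultisets hF]
    exact ⟨⟨ht.add hu.1, by rw [Multiset.card_add, htj, hu.2]; omega⟩, Multiset.le_add_right _ _⟩
  · intro s hs
    rw [add_comm, Multiset.sub_add_cancel (Finset.mem_filter.1 hs).2]
  · intro u hu
    exact add_tsub_cancel_left t u
  · intro s hs
    rw [Finset.mem_filter, mem_stableMultisets hF] at hs
    obtain ⟨⟨h1, h2⟩, h3⟩ := hs
    have h4 : t + (s - t) = s := by rw [add_comm, Multiset.sub_add_cancel h3]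
    conv_lhs => rw [← h4]
    exact divChar_add hF f ht (ht.of_add (by rwa [h4]))

lemma lCoeff_zero {m : ℕ} (hF : Nat.card F = 2 ^ m) (f : F[X]) : lCoeff K m f 0 = 1 := by
  have h : stableMultisets F K 0 = {0} := by
    ext s
    rw [mem_stableMultisets hF, Finset.mem_singleton, Multiset.card_eq_zero]
    exact ⟨fun h => h.2, fun h => ⟨by rw [h]; rfl, h⟩⟩
  simp [lCoeff, h, divChar, absTr_zero]

variable [CharP F 2]

/-- The logarithmic derivative of the `L`-function: `k A_k = ∑_{j=1}^k S_j A_{k-j}`. -/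
theorem mul_lCoeff {m : ℕ} (hF : Nat.card F = 2 ^ m) (f : F[X]) (k : ℕ) :
    k * lCoeff K m f k = ∑ j ∈ Finset.Icc 1 k, expSum f j * lCoeff K m f (k - j) := by
  classical
  have hm := ne_zero_of_natCard hF
  -- Weight each divisor `s` by its degree `∑ x, s.count x`, expand the multiplicities as numbers of
  -- orbit segments, and sum over the divisors first.
  let φ : K → K := fun x => x ^ 2 ^ m
  have hφ : Function.Injective φ := pow_frob_injective m
  let U : Finset K := (Finset.Icc 1 k).biUnion fun j => frobSet K (m * j)
  have hcount : ∀ s ∈ stableMultisets F K k, ∀ x, s.count x =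
      ((Finset.Icc 1 k).filter fun j => φ^[j] x = x ∧ orbitSeg φ j x ≤ s).card := by
    intro s hs x
    rw [mem_stableMultisets hF] at hs
    rw [count_eq_card_orbitSeg hφ hs.1 x, hs.2]
  have hcard : ∀ s ∈ stableMultisets F K k, k = ∑ x ∈ U, s.count x := by
    intro s hs
    rw [Multiset.sum_count_eq_card, ((mem_stableMultisets hF).1 hs).2]
    intro x hx
    rw [← Multiset.count_pos, hcount s hs x, Finset.card_pos] at hx
    obtain ⟨j, hj⟩ := hx
    obtain ⟨h1, h2, -⟩ := Finset.mem_filter.1 hj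
    refine Finset.mem_biUnion.2 ⟨j, h1, ?_⟩
    rw [mem_frobSet (mul_ne_zero hm (Nat.one_le_iff_ne_zero.1 (Finset.mem_Icc.1 h1).1)),
      ← iterate_pow_frob]
    exact h2
  calc (k : ℤ) * lCoeff K m f k
      = ∑ s ∈ stableMultisets F K k, ∑ x ∈ U, ∑ j ∈ Finset.Icc 1 k,
          if φ^[j] x = x ∧ orbitSeg φ j x ≤ s then divChar m f s else 0 := by
        rw [lCoeff, Finset.mul_sum]
        refine Finset.sum_congr rfl fun s hs => ?_
        conv_lhs => rw [hcard s hs]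
        rw [Nat.cast_sum, Finset.sum_mul]
        refine Finset.sum_congr rfl fun x _ => ?_
        rw [hcount s hs x, ← Finset.sum_filter, Finset.sum_const, nsmul_eq_mul]
    _ = ∑ j ∈ Finset.Icc 1 k, ∑ x ∈ U, ∑ s ∈ stableMultisets F K k,
          if φ^[j] x = x ∧ orbitSeg φ j x ≤ s then divChar m f s else 0 := by
        rw [Finset.sum_comm, Finset.sum_congr rfl fun x _ => Finset.sum_comm, Finset.sum_comm]
    _ = _ := by
        refine Finset.sum_congr rfl fun j hj => ?_
        obtain ⟨h1, h2⟩ := Finset.mem_Icc.1 hj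
        have hmj : m * j ≠ 0 := mul_ne_zero hm (Nat.one_le_iff_ne_zero.1 h1)
        rw [expSum_eq (K := K) hF f (Nat.one_le_iff_ne_zero.1 h1), Finset.sum_mul]
        have hsub : frobSet K (m * j) ⊆ U := fun x hx => Finset.mem_biUnion.2 ⟨j, hj, hx⟩
        rw [← Finset.sum_subset hsub]
        · refine Finset.sum_congr rfl fun x hx => ?_
          have hx' : φ^[j] x = x := by
            rw [mem_frobSet hmj] at hx
            rw [iterate_pow_frob, hx]
          simp only [hx', true_and]
          rw [← Finset.sum_filter, sum_divChar_of_le hF f h2 (map_orbitSeg hx')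
            (card_orbitSeg φ j x), divChar_orbitSeg hF]
        · intro x _ hx
          refine Finset.sum_eq_zero fun s _ => if_neg fun h => hx ?_
          rw [mem_frobSet hmj, ← iterate_pow_frob]
          exact h.1

end Divisors

/-! ### Polynomiality of the `L`-function -/

section Newton

variable {K : Type*} [Field K]

/-- Newton's identity for the elements of a multiset. -/
lemma sum_map_pow_eq (s : Multiset K) {n : ℕ} (hn : 0 < n) :
    (s.map fun r => r ^ n).sum = (-1) ^ (n + 1) * n * s.esymm n -
      ∑ b ∈ Finset.HasAntidiagonal.antidiagonal n with b.1 ∈ Set.Ioo 0 n,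
        (-1) ^ b.1 * s.esymm b.1 * (s.map fun r => r ^ b.2).sum := by
  obtain ⟨l, rfl⟩ := Quot.exists_rep s
  have hl : Finset.univ.val.map l.get = (Quot.mk _ l : Multiset K) := by
    change _ = (l : Multiset K)
    rw [Fin.univ_val_map, List.ofFn_get]
  have hes : ∀ j, MvPolynomial.aeval l.get (MvPolynomial.esymm (Fin l.length) K j) =
      Multiset.esymm (Quot.mk _ l) j := fun j => by
    rw [MvPolynomial.aeval_esymm_eq_multiset_esymm, hl]
  have hps : ∀ j, MvPolynomial.aeval l.get (MvPolynomial.psum (Fin l.length) K j) =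
      (Multiset.map (fun r => r ^ j) (Quot.mk _ l)).sum := fun j => by
    rw [← hl, Multiset.map_map, MvPolynomial.psum, map_sum]
    simp [Finset.sum]
  have h := congrArg (MvPolynomial.aeval l.get)
    (MvPolynomial.psum_eq_mul_esymm_sub_sum (Fin l.length) K n hn)
  simpa only [map_sub, map_mul, map_pow, map_neg, map_one, map_natCast, map_sum, hes, hps] using h

/-- Power sums of order less than `D` depend only on the elementary symmetric functions of order
less than `D`; the one of order `D` is affine in the `D`-th elementary symmetric function. -/
lemma sum_map_pow_congr {s t : Multiset K} {D : ℕ} (h : ∀ j < D, s.esymm j = t.esymm j) :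
    (∀ n, 0 < n → n < D → (s.map fun r => r ^ n).sum = (t.map fun r => r ^ n).sum) ∧
    (0 < D → (s.map fun r => r ^ D).sum = (t.map fun r => r ^ D).sum +
      (-1) ^ (D + 1) * D * (s.esymm D - t.esymm D)) := by
  have h1 : ∀ n, 0 < n → n < D → (s.map fun r => r ^ n).sum = (t.map fun r => r ^ n).sum := by
    intro n
    induction n using Nat.strong_induction_on with
    | _ n ih =>
      intro hn hnD
      rw [sum_map_pow_eq s hn, sum_map_pow_eq t hn, h n hnD]
      congr 1
      refine Finset.sum_congr rfl fun b hb => ?_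
      obtain ⟨hb1, hb2⟩ := Finset.mem_filter.1 hb
      rw [Finset.HasAntidiagonal.mem_antidiagonal] at hb1
      have h2 : 0 < b.1 := hb2.1
      have h3 : b.1 < n := hb2.2
      rw [h b.1 (by omega), ih b.2 (by omega) (by omega) (by omega)]
  refine ⟨h1, fun hD => ?_⟩
  rw [sum_map_pow_eq s hD, sum_map_pow_eq t hD]
  have h4 : ∑ b ∈ Finset.HasAntidiagonal.antidiagonal D with b.1 ∈ Set.Ioo 0 D,
        (-1) ^ b.1 * s.esymm b.1 * (s.map fun r => r ^ b.2).sum =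
      ∑ b ∈ Finset.HasAntidiagonal.antidiagonal D with b.1 ∈ Set.Ioo 0 D,
        (-1) ^ b.1 * t.esymm b.1 * (t.map fun r => r ^ b.2).sum := by
    refine Finset.sum_congr rfl fun b hb => ?_
    obtain ⟨hb1, hb2⟩ := Finset.mem_filter.1 hb
    rw [Finset.HasAntidiagonal.mem_antidiagonal] at hb1
    have h2 : 0 < b.1 := hb2.1
    have h3 : b.1 < D := hb2.2
    rw [h b.1 (by omega), h1 b.2 (by omega) (by omega)]
  rw [h4]; ring

end Newton

section Vanishing

variable {F : Type*} [Field F] {K : Type*} [Field K] [Algebra F K]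

lemma sum_aeval_quadPoly (d : ℕ) (a : ℕ → F) (s : Multiset K) :
    (s.map fun r => aeval r (quadPoly d a)).sum =
      ∑ i ∈ Finset.range (d + 1),
        algebraMap F K (a i) * (s.map fun r => r ^ (2 ^ i + 1)).sum := by
  induction s using Multiset.induction_on with
  | empty => simp
  | cons r s ih =>
    simp only [Multiset.map_cons, Multiset.sum_cons, ih, mul_add, Finset.sum_add_distrib]
    congr 1
    rw [aeval_quadPoly, aeval_linPoly, Finset.mul_sum]
    exact Finset.sum_congr rfl fun i _ => by ring

lemma exists_sgn_absTr_eq_neg_one [Finite F] {m : ℕ} (hF : Nat.card F = 2 ^ m) [CharP F 2] :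
    ∃ c : F, sgn (absTr m (algebraMap F K c)) = -1 := by
  let := Fintype.ofFinite F
  have hF' : Fintype.card F = 2 ^ m := by rw [Fintype.card_eq_nat_card, hF]
  have h := traceChar_isPrimitive hF' one_ne_zero
  rw [AddChar.mulShift_one, AddChar.ne_one_iff] at h
  obtain ⟨c, hc⟩ := h
  refine ⟨c, ?_⟩
  rw [traceChar_apply] at hc
  have h1 : absTr m (algebraMap F K c) = algebraMap F K (absTr m c) := by simp [absTr]
  have h2 : sgn (algebraMap F K (absTr m c)) = sgn (absTr m c) := by
    by_cases h : absTr m c = 0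
    · rw [h, map_zero, sgn_zero, sgn_zero]
    · rw [sgn, sgn, if_neg ((map_ne_zero (algebraMap F K)).2 h), if_neg h]
  rw [h1, h2]
  exact (sgn_eq_or _).resolve_left hc

variable [CharP K 2] [IsAlgClosed K]

lemma esymm_aroots {g : F[X]} (hg : g.Monic) {j : ℕ} (hj : j ≤ g.natDegree) :
    (g.aroots K).esymm j = algebraMap F K (g.coeff (g.natDegree - j)) := by
  have h := Polynomial.coeff_eq_esymm_roots_of_splits
    (IsAlgClosed.splits (g.map (algebraMap F K))) (k := g.natDegree - j) (by
      rw [natDegree_map]; omega)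
  rw [coeff_map, natDegree_map, (hg.map _).leadingCoeff, CharTwo.neg_eq, one_pow, one_mul,
    one_mul, Nat.sub_sub_self hj] at h
  exact h.symm

/-- Changing the coefficient of index `k - (2^d + 1)` of a monic polynomial of degree `k` by `c`
changes the sum of `f` over its roots by `a_d c`. -/
lemma sum_aeval_aroots_add {d : ℕ} (hd : 1 ≤ d) (a : ℕ → F) {k : ℕ} (hk : 2 ^ d + 1 ≤ k)
    {g : F[X]} (hg : g ∈ monics F k) (c : F) :
    g + C c * X ^ (k - (2 ^ d + 1)) ∈ monics F k ∧
    (((g + C c * X ^ (k - (2 ^ d + 1))).aroots K).map fun r => aeval r (quadPoly d a)).sum =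
      ((g.aroots K).map fun r => aeval r (quadPoly d a)).sum +
        algebraMap F K (a d * c) := by
  set D := 2 ^ d + 1 with hD
  have h2d : 0 < 2 ^ d := Nat.two_pow_pos d
  obtain ⟨hgm, hgk⟩ := hg
  have hlt : (C c * X ^ (k - D) : F[X]).degree < g.degree := by
    refine (degree_C_mul_X_pow_le _ _).trans_lt ?_
    rw [degree_eq_natDegree hgm.ne_zero, hgk]
    exact_mod_cast (by omega : k - D < k)
  have hg'm : (g + C c * X ^ (k - D)).Monic := hgm.add_of_left hlt
  have hg'k : (g + C c * X ^ (k - D)).natDegree = k := by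
    rw [natDegree_add_eq_left_of_degree_lt hlt, hgk]
  refine ⟨⟨hg'm, hg'k⟩, ?_⟩
  have hes : ∀ j ≤ D, ((g + C c * X ^ (k - D)).aroots K).esymm j =
      (g.aroots K).esymm j + if j = D then algebraMap F K c else 0 := by
    intro j hj
    rw [esymm_aroots hg'm (by omega), esymm_aroots hgm (by omega), hg'k, hgk, coeff_add,
      coeff_C_mul_X_pow, map_add]
    congr 1
    by_cases h : j = D
    · simp [h]
    · rw [if_neg (by omega), if_neg h, map_zero]
  obtain ⟨h1, h2⟩ := sum_map_pow_congr (s := (g + C c * X ^ (k - D)).aroots K)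
    (t := g.aroots K) (D := D) (fun j hj => by rw [hes j hj.le, if_neg hj.ne, add_zero])
  have h3 := h2 (by omega)
  rw [hes D le_rfl, if_pos rfl, add_sub_cancel_left] at h3
  have hDodd : Odd D := by
    rw [hD]
    exact ((Nat.even_pow.2 ⟨even_two, by omega⟩).add_one)
  rw [natCast_eq_one_of_odd K hDodd, CharTwo.neg_eq, one_pow, one_mul, one_mul] at h3
  rw [sum_aeval_quadPoly, sum_aeval_quadPoly, Finset.sum_range_succ, Finset.sum_range_succ,
    ← hD, h3, mul_add, ← add_assoc, ← map_mul]
  congr 2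
  refine Finset.sum_congr rfl fun i hi => ?_
  have h2i : 0 < 2 ^ i := Nat.two_pow_pos i
  have : 2 ^ i < 2 ^ d := Nat.pow_lt_pow_right (by norm_num) (Finset.mem_range.1 hi)
  rw [h1 _ (by omega) (by omega)]

variable [Finite F]

/-- In degree `k > 2^d`, adding a suitable multiple of `X^{k - 2^d - 1}` to the monic polynomials pairs
opposite terms, so the `L`-function is a polynomial of degree at most `2^d`. -/
theorem lCoeff_eq_zero [CharP F 2] {m : ℕ} (hF : Nat.card F = 2 ^ m) {d : ℕ} (hd : 1 ≤ d)
    {a : ℕ → F} (ha : a d ≠ 0) {k : ℕ} (hk : 2 ^ d < k) :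
    lCoeff K m (quadPoly d a) k = 0 := by
  classical
  obtain ⟨c₀, hc₀⟩ := exists_sgn_absTr_eq_neg_one (K := K) hF
  -- The translation constant `c` is chosen with `Tr(a_d c) = 1`.
  obtain ⟨c, rfl⟩ : ∃ c, c₀ = a d * c := ⟨(a d)⁻¹ * c₀, by field_simp⟩
  have hsum : lCoeff K m (quadPoly d a) k =
      ∑ g ∈ (finite_monics (F := F) k).toFinset, divChar m (quadPoly d a) (g.aroots K) := by
    rw [lCoeff, stableMultisets, Finset.sum_image]
    intro g hg h hh
    simp only [Finset.mem_coe, Set.Finite.mem_toFinset] at hg hh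
    exact aroots_injective_of_monic hg.1 hh.1
  have hneg : ∀ g ∈ monics F k,
      divChar m (quadPoly d a) ((g + C c * X ^ (k - (2 ^ d + 1))).aroots K) =
        - divChar m (quadPoly d a) (g.aroots K) := by
    intro g hg
    rw [divChar, (sum_aeval_aroots_add hd a hk hg c).2,
      sgn_absTr_add (sum_aeval_pow_frob hF _ (isFrobStable_aroots hF g))
        (pow_natCard_algebraMap hF _), hc₀, divChar]
    ring
  have hinv : ∑ g ∈ (finite_monics (F := F) k).toFinset,
        divChar m (quadPoly d a) ((g + C c * X ^ (k - (2 ^ d + 1))).aroots K) =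
      ∑ g ∈ (finite_monics (F := F) k).toFinset, divChar m (quadPoly d a) (g.aroots K) := by
    have : CharP F[X] 2 := inferInstance
    have hadd : ∀ g : F[X], g + C c * X ^ (k - (2 ^ d + 1)) + C c * X ^ (k - (2 ^ d + 1)) = g :=
      fun g => by rw [add_assoc, CharTwo.add_self_eq_zero, add_zero]
    have hmem : ∀ g ∈ (finite_monics (F := F) k).toFinset,
        g + C c * X ^ (k - (2 ^ d + 1)) ∈ (finite_monics (F := F) k).toFinset := by
      intro g hg
      rw [Set.Finite.mem_toFinset] at hg ⊢
      exact (sum_aeval_aroots_add (K := K) hd a hk hg c).1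
    exact Finset.sum_bij' (fun g _ => g + C c * X ^ (k - (2 ^ d + 1)))
      (fun g _ => g + C c * X ^ (k - (2 ^ d + 1))) hmem hmem (fun g _ => hadd g)
      (fun g _ => hadd g) (fun g _ => rfl)
  rw [Finset.sum_congr rfl fun g hg => hneg g ((finite_monics k).mem_toFinset.1 hg),
    Finset.sum_neg_distrib, ← hsum] at hinv
  omega

end Vanishing

section LFun

variable {F : Type*} [Field F] [Finite F] [CharP F 2]

lemma derivative_LFun (f : F[X]) : PowerSeries.derivative ℂ (LFun f) =
    LFun f * PowerSeries.mk fun n => (expSum f (n + 1) : ℂ) := by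
  set B : PowerSeries ℂ :=
    PowerSeries.mk fun n => if n = 0 then (0 : ℂ) else (expSum f n : ℂ) / n with hB
  have hs : PowerSeries.HasSubst B := PowerSeries.HasSubst.of_constantCoeff_zero' (by
    rw [← PowerSeries.coeff_zero_eq_constantCoeff_apply, hB, PowerSeries.coeff_mk, if_pos rfl])
  have hd := PowerSeries.derivative_subst (f := PowerSeries.exp ℂ) hs
  rw [PowerSeries.derivative_exp] at hd
  have hB' : PowerSeries.derivative ℂ B = PowerSeries.mk fun n => (expSum f (n + 1) : ℂ) := by
    ext n
    have : (n : ℂ) + 1 ≠ 0 := Nat.cast_add_one_ne_zero n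
    rw [PowerSeries.coeff_derivative, hB, PowerSeries.coeff_mk, PowerSeries.coeff_mk,
      if_neg (Nat.succ_ne_zero n)]
    push_cast
    field_simp
  rw [← hB']
  exact hd

lemma mul_coeff_LFun (f : F[X]) (k : ℕ) :
    (k : ℂ) * PowerSeries.coeff k (LFun f) =
      ∑ j ∈ Finset.Icc 1 k, (expSum f j : ℂ) * PowerSeries.coeff (k - j) (LFun f) := by
  rcases k with _ | k
  · simp
  have h := congrArg (PowerSeries.coeff k) (derivative_LFun f)
  rw [PowerSeries.coeff_derivative, mul_comm, PowerSeries.coeff_mul] at h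
  push_cast
  refine h.trans ?_
  refine Finset.sum_bij' (fun b _ => b.2 + 1) (fun j _ => (k + 1 - j, j - 1)) ?_ ?_ ?_ ?_ ?_
  · intro b hb
    rw [Finset.HasAntidiagonal.mem_antidiagonal] at hb
    rw [Finset.mem_Icc]; omega
  · intro j hj
    rw [Finset.mem_Icc] at hj
    rw [Finset.HasAntidiagonal.mem_antidiagonal]
    change k + 1 - j + (j - 1) = k
    omega
  · rintro ⟨b₁, b₂⟩ hb
    rw [Finset.HasAntidiagonal.mem_antidiagonal] at hb
    ext <;> simp at hb ⊢; omega
  · intro j hj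
    rw [Finset.mem_Icc] at hj
    change j - 1 + 1 = j
    omega
  · rintro ⟨b₁, b₂⟩ hb
    rw [Finset.HasAntidiagonal.mem_antidiagonal] at hb
    have hb1 : k + 1 - (b₂ + 1) = b₁ := by simp at hb; omega
    rw [hb1, PowerSeries.coeff_mk, mul_comm]

lemma coeff_zero_LFun (f : F[X]) : PowerSeries.coeff 0 (LFun f) = 1 := by
  set B : PowerSeries ℂ :=
    PowerSeries.mk fun n => if n = 0 then (0 : ℂ) else (expSum f n : ℂ) / n with hB
  have hB0 : PowerSeries.constantCoeff B = 0 := by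
    rw [← PowerSeries.coeff_zero_eq_constantCoeff_apply, hB, PowerSeries.coeff_mk, if_pos rfl]
  have hs : PowerSeries.HasSubst B := PowerSeries.HasSubst.of_constantCoeff_zero' hB0
  rw [LFun, PowerSeries.coeff_subst' hs, finsum_eq_single _ 0]
  · simp
  · intro n hn
    rw [PowerSeries.coeff_zero_eq_constantCoeff_apply, map_pow, hB0, zero_pow hn, smul_zero]

theorem coeff_LFun {m : ℕ} (hF : Nat.card F = 2 ^ m) (f : F[X]) (k : ℕ) :
    PowerSeries.coeff k (LFun f) = (lCoeff (AlgebraicClosure F) m f k : ℂ) := by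
  have : CharP (AlgebraicClosure F) 2 := charP_of_algebra F _
  induction k using Nat.strong_induction_on with
  | _ k ih =>
    rcases Nat.eq_zero_or_pos k with rfl | hk
    · rw [coeff_zero_LFun, lCoeff_zero hF, Int.cast_one]
    · have h1 := mul_coeff_LFun f k
      have h2 := congrArg (Int.cast : ℤ → ℂ) (mul_lCoeff (K := AlgebraicClosure F) hF f k)
      push_cast at h2
      have hk' : (k : ℂ) ≠ 0 := Nat.cast_ne_zero.2 hk.ne'
      apply mul_left_cancel₀ hk'
      rw [h1, h2]
      refine Finset.sum_congr rfl fun j hj => ?_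
      have := Finset.mem_Icc.1 hj
      rw [ih (k - j) (by omega)]

end LFun

/-! ### Products of linear factors and power sums -/

section LinProd

/-- The polynomial `∏ (1 - w T)`, `w` running over a multiset of complex numbers. -/
def linProd (W : Multiset ℂ) : ℂ[X] := (W.map fun w => 1 - C w * X).prod

lemma linProd_add (W W' : Multiset ℂ) : linProd (W + W') = linProd W * linProd W' := by
  simp [linProd]

lemma linProd_ne_zero (W : Multiset ℂ) : linProd W ≠ 0 := by
  have h : (linProd W).coeff 0 = 1 := by
    rw [linProd, coeff_zero_multiset_prod, Multiset.map_map]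
    refine Multiset.prod_eq_one fun x hx => ?_
    obtain ⟨w, -, rfl⟩ := Multiset.mem_map.1 hx
    simp
  intro h0
  rw [h0, coeff_zero] at h
  exact zero_ne_one h

lemma exists_eq_linProd {p : ℂ[X]} (hp : p.coeff 0 = 1) :
    ∃ W : Multiset ℂ, 0 ∉ W ∧ p = linProd W := by
  have hp0 : p ≠ 0 := by rintro rfl; simp at hp
  have hr : ∀ r ∈ p.roots, r ≠ 0 := by
    rintro r hr rfl
    have := (mem_roots hp0).1 hr
    rw [IsRoot.def, ← coeff_zero_eq_eval_zero, hp] at this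
    exact one_ne_zero this
  refine ⟨p.roots.map fun r => r⁻¹, ?_, ?_⟩
  · intro h
    obtain ⟨r, h1, h2⟩ := Multiset.mem_map.1 h
    exact hr r h1 (inv_eq_zero.1 h2)
  · have key : ∀ s : Multiset ℂ, (∀ r ∈ s, r ≠ 0) → (s.map fun r => X - C r).prod =
        C (s.map fun r => -r).prod * linProd (s.map fun r => r⁻¹) := by
      intro s
      induction s using Multiset.induction_on with
      | empty => simp [linProd]
      | cons r s ih =>
        intro hs
        have hr0 : r ≠ 0 := hs r (Multiset.mem_cons_self r s)
        have h1 : X - C r = C (-r) * (1 - C r⁻¹ * X) := by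
          rw [mul_sub, mul_one, ← mul_assoc, ← C_mul]
          rw [neg_mul, mul_inv_cancel₀ hr0]
          simp; ring
        rw [Multiset.map_cons, Multiset.prod_cons,
          ih fun x hx => hs x (Multiset.mem_cons_of_mem hx), h1]
        simp only [linProd, Multiset.map_cons, Multiset.prod_cons, C_mul]
        ring
    have h1 := (IsAlgClosed.splits p).eq_prod_roots
    have h2 : p.coeff 0 = p.leadingCoeff * (p.roots.map fun r => -r).prod :=
      (IsAlgClosed.splits p).coeff_zero_eq_leadingCoeff_mul_prod_roots.trans (by
        rw [Multiset.prod_map_neg, ← (IsAlgClosed.splits p).natDegree_eq_card_roots]; ring)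
    rw [key _ hr, ← mul_assoc, ← C_mul, ← h2, hp, C_1, one_mul] at h1
    exact h1

lemma derivative_linProd (W : Multiset ℂ) :
    PowerSeries.derivative ℂ (linProd W : PowerSeries ℂ) =
      (linProd W : PowerSeries ℂ) * PowerSeries.mk fun n => -(W.map fun w => w ^ (n + 1)).sum := by
  induction W using Multiset.induction_on with
  | empty =>
    have : (PowerSeries.mk fun n => -((0 : Multiset ℂ).map fun w => w ^ (n + 1)).sum) = 0 := by
      ext n; simp
    rw [this, mul_zero]
    simp [linProd]
  | cons w W ih =>
    have h1 : linProd (w ::ₘ W) = (1 - C w * X) * linProd W := by simp [linProd]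
    have h2 : (PowerSeries.mk fun n => -((w ::ₘ W).map fun w => w ^ (n + 1)).sum) =
        (PowerSeries.mk fun n => -w ^ (n + 1)) +
          PowerSeries.mk fun n => -(W.map fun w => w ^ (n + 1)).sum := by
      ext n; simp; ring
    have h3 : PowerSeries.derivative ℂ ((1 - C w * X : ℂ[X]) : PowerSeries ℂ) =
        ((1 - C w * X : ℂ[X]) : PowerSeries ℂ) * PowerSeries.mk fun n => -w ^ (n + 1) := by
      have hc : ((1 - C w * X : ℂ[X]) : PowerSeries ℂ) = 1 - PowerSeries.C w * PowerSeries.X := by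
        simp
      rw [hc]
      ext n
      rw [PowerSeries.coeff_derivative, sub_mul, one_mul, map_sub, map_sub, mul_assoc,
        PowerSeries.coeff_C_mul, PowerSeries.coeff_C_mul, PowerSeries.coeff_mk,
        PowerSeries.coeff_one, if_neg (Nat.succ_ne_zero n)]
      rcases n with _ | n
      · simp
      · rw [PowerSeries.coeff_succ_X_mul, PowerSeries.coeff_mk, PowerSeries.coeff_X,
          if_neg (by omega)]
        ring
    rw [h1, coe_mul, Derivation.leibniz, h2, ih, h3]
    simp only [smul_eq_mul]
    ring

/-- A vanishing combination of the first `|Z|` powers is trivial (Vandermonde). -/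
lemma eq_zero_of_sum_mul_pow_eq_zero (Z : Finset ℂ) (c : ℂ → ℂ)
    (h : ∀ j < Z.card, ∑ w ∈ Z, c w * w ^ j = 0) : ∀ w ∈ Z, c w = 0 := by
  classical
  intro w₀ hw₀
  -- The combination is tested against a polynomial that vanishes on `Z` except at `w₀`.
  set p : ℂ[X] := ∏ w ∈ Z.erase w₀, (X - C w) with hp
  have hdeg : p.natDegree < Z.card := by
    rw [hp, natDegree_finsetProd_X_sub_C_eq_card, Finset.card_erase_of_mem hw₀]
    have := Finset.card_pos.2 ⟨w₀, hw₀⟩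
    omega
  have h1 : ∑ w ∈ Z, c w * p.eval w = 0 := by
    simp_rw [eval_eq_sum_range, Finset.mul_sum]
    rw [Finset.sum_comm]
    refine Finset.sum_eq_zero fun j hj => ?_
    have hj' : j < Z.card := by have := Finset.mem_range.1 hj; omega
    have h2 : ∑ w ∈ Z, c w * (p.coeff j * w ^ j) = p.coeff j * ∑ w ∈ Z, c w * w ^ j := by
      rw [Finset.mul_sum]
      exact Finset.sum_congr rfl fun w _ => by ring
    rw [h2, h j hj', mul_zero]
  rw [Finset.sum_eq_single_of_mem w₀ hw₀] at h1
  · refine (mul_eq_zero.1 h1).resolve_right ?_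
    rw [hp, eval_prod]
    refine Finset.prod_ne_zero_iff.2 ?_
    intro w hw
    rw [eval_sub, eval_X, eval_C]
    exact sub_ne_zero.2 (Finset.ne_of_mem_erase hw).symm
  · intro w hw hne
    rw [hp, eval_prod, Finset.prod_eq_zero (Finset.mem_erase.2 ⟨hne, hw⟩), mul_zero]
    simp

lemma sum_map_eq_sum_count [DecidableEq ℂ] (W : Multiset ℂ) {Z : Finset ℂ} (hZ : W.toFinset ⊆ Z)
    (g : ℂ → ℂ) : (W.map g).sum = ∑ w ∈ Z, (W.count w : ℂ) * g w := by
  rw [Finset.sum_multiset_map_count, ← Finset.sum_subset hZ]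
  · exact Finset.sum_congr rfl fun w _ => by rw [nsmul_eq_mul]
  · intro w _ hw
    rw [Multiset.count_eq_zero_of_notMem (fun h => hw (Multiset.mem_toFinset.2 h))]
    simp

/-- A multiset of nonzero complex numbers is determined by its power sums of positive order. -/
lemma multiset_eq_of_power_sums {W W' : Multiset ℂ} (hW : 0 ∉ W) (hW' : 0 ∉ W')
    (h : ∀ n, 1 ≤ n → (W.map fun w => w ^ n).sum = (W'.map fun w => w ^ n).sum) : W = W' := by
  classical
  set Z := W.toFinset ∪ W'.toFinset with hZ
  have hZ0 : ∀ w ∈ Z, w ≠ 0 := by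
    rintro w hw rfl
    rcases Finset.mem_union.1 hw with h | h
    · exact hW (Multiset.mem_toFinset.1 h)
    · exact hW' (Multiset.mem_toFinset.1 h)
  have key := eq_zero_of_sum_mul_pow_eq_zero Z
    (fun w => ((W.count w : ℂ) - W'.count w) * w) (fun j _ => by
      have h1 := h (j + 1) (by omega)
      rw [sum_map_eq_sum_count W Finset.subset_union_left,
        sum_map_eq_sum_count W' Finset.subset_union_right, ← sub_eq_zero,
        ← Finset.sum_sub_distrib] at h1
      rw [← h1]
      exact Finset.sum_congr rfl fun w _ => by ring)
  ext w
  by_cases hw : w ∈ Z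
  · have h1 := (mul_eq_zero.1 (key w hw)).resolve_right (hZ0 w hw)
    exact_mod_cast sub_eq_zero.1 h1
  · rw [hZ, Finset.notMem_union, Multiset.mem_toFinset, Multiset.mem_toFinset] at hw
    rw [Multiset.count_eq_zero_of_notMem hw.1, Multiset.count_eq_zero_of_notMem hw.2]

lemma linProd_injective {W W' : Multiset ℂ} (hW : 0 ∉ W) (hW' : 0 ∉ W')
    (h : linProd W = linProd W') : W = W' := by
  refine multiset_eq_of_power_sums hW hW' fun n hn => ?_
  have h1 := derivative_linProd W
  rw [h, derivative_linProd W'] at h1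
  have h2 := mul_left_cancel₀ (by
    rw [Ne, Polynomial.coe_eq_zero_iff]; exact linProd_ne_zero W') h1
  have h3 := congrArg (PowerSeries.coeff (n - 1)) h2
  rw [PowerSeries.coeff_mk, PowerSeries.coeff_mk, Nat.sub_add_cancel hn] at h3
  exact (neg_injective h3).symm

/-- If the power sums of a finite multiset of nonzero complex numbers take finitely many values,
then the numbers are roots of unity of a common order: by pigeonhole two long enough windows of the
sequence of power sums coincide. -/
lemma exists_pow_eq_one_of_finite {W : Multiset ℂ} (hW : 0 ∉ W) {V : Set ℂ} (hV : V.Finite)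
    (h : ∀ n, 1 ≤ n → (W.map fun w => w ^ n).sum ∈ V) : ∃ P, 0 < P ∧ ∀ w ∈ W, w ^ P = 1 := by
  classical
  have : Finite V := hV
  obtain ⟨n, n', hne, heq⟩ := Finite.exists_ne_map_eq_of_infinite
    (fun (n : ℕ) (j : Fin W.toFinset.card) =>
      (⟨_, h (n + j + 1) (by omega)⟩ : V))
  wlog hlt : n < n' generalizing n n'
  · exact this n' n hne.symm heq.symm (by omega)
  have key := eq_zero_of_sum_mul_pow_eq_zero W.toFinset
    (fun w => (W.count w : ℂ) * w * (w ^ n - w ^ n')) (fun j hj => by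
      have h1 := congrArg Subtype.val (congrFun heq ⟨j, hj⟩)
      simp only [sum_map_eq_sum_count W subset_rfl] at h1
      rw [← sub_eq_zero, ← Finset.sum_sub_distrib] at h1
      rw [← h1]
      exact Finset.sum_congr rfl fun w _ => by ring)
  refine ⟨n' - n, by omega, fun w hw => ?_⟩
  have hw0 : w ≠ 0 := by rintro rfl; exact hW hw
  have h1 := key w (Multiset.mem_toFinset.2 hw)
  have h2 : (W.count w : ℂ) ≠ 0 := Nat.cast_ne_zero.2 (Multiset.count_pos.2 hw).ne'
  have h3 := (mul_eq_zero.1 h1).resolve_left (mul_ne_zero h2 hw0)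
  have h4 : w ^ n * w ^ (n' - n) = w ^ n * 1 := by
    rw [← pow_add, Nat.add_sub_cancel' hlt.le, mul_one, sub_eq_zero.1 h3]
  exact mul_left_cancel₀ (pow_ne_zero n hw0) h4

end LinProd

/-! ### Eighth roots of unity -/

section Eighth

lemma zeta_isPrimitiveRoot {l : ℕ} (hl : l ≠ 0) : IsPrimitiveRoot (zeta l) l :=
  Complex.isPrimitiveRoot_exp l hl

lemma zeta_mul_pow {l k : ℕ} (hl : l ≠ 0) (hk : k ≠ 0) : zeta (l * k) ^ k = zeta l := by
  rw [zeta, zeta, ← Complex.exp_nat_mul]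
  congr 1
  push_cast
  have : (l : ℂ) ≠ 0 := Nat.cast_ne_zero.2 hl
  have : (k : ℂ) ≠ 0 := Nat.cast_ne_zero.2 hk
  field_simp

lemma zeta_eight_pow_four : zeta 8 ^ 4 = -1 := by
  have h := zeta_mul_pow (l := 2) (k := 4) (by norm_num) (by norm_num)
  norm_num at h
  rw [h, zeta, ← Complex.exp_pi_mul_I]
  congr 1
  push_cast; ring

lemma zeta_eight_pow_eight : zeta 8 ^ 8 = 1 := (zeta_isPrimitiveRoot (by norm_num)).pow_eq_one

lemma zeta_eight_add : zeta 8 + zeta 8 ^ 7 = ((Real.sqrt 2 : ℝ) : ℂ) := by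
  have h1 : zeta 8 ^ 7 = (zeta 8)⁻¹ := by
    exact eq_inv_of_mul_eq_one_left ((pow_succ _ _).symm.trans zeta_eight_pow_eight)
  have h2 : zeta 8 = Complex.exp (((Real.pi / 4 : ℝ) : ℂ) * Complex.I) := by
    rw [zeta]; congr 1; push_cast; ring
  rw [h1, h2, ← Complex.exp_neg, ← neg_mul, ← Complex.two_cos, ← Complex.ofReal_cos,
    Real.cos_pi_div_four]
  push_cast; ring

/-- The action of `ζ_8 ↦ ζ_8^i` on `√2 = ζ_8 + ζ_8^7`. -/
lemma zeta_eight_pow_add {i : ℕ} (hi : Odd i) :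
    zeta 8 ^ i + zeta 8 ^ (7 * i) = chi i * ((Real.sqrt 2 : ℝ) : ℂ) := by
  have h8 := zeta_eight_pow_eight
  have h4 := zeta_eight_pow_four
  have hmod : ∀ j, zeta 8 ^ j = zeta 8 ^ (j % 8) := fun j => by
    conv_lhs => rw [← Nat.div_add_mod j 8, pow_add, pow_mul, h8, one_pow, one_mul]
  have hχ : chi i = ZMod.χ₈ ((i % 8 : ℕ) : ZMod 8) := by rw [chi, ZMod.natCast_mod]
  rw [hmod i, hmod (7 * i), Nat.mul_mod, hχ, ← zeta_eight_add]
  have h1 : i % 8 = 1 ∨ i % 8 = 3 ∨ i % 8 = 5 ∨ i % 8 = 7 := by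
    obtain ⟨k, rfl⟩ := hi; omega
  have c1 : ZMod.χ₈ ((1 : ℕ) : ZMod 8) = 1 := by decide
  have c3 : ZMod.χ₈ ((3 : ℕ) : ZMod 8) = -1 := by decide
  have c5 : ZMod.χ₈ ((5 : ℕ) : ZMod 8) = -1 := by decide
  have c7 : ZMod.χ₈ ((7 : ℕ) : ZMod 8) = 1 := by decide
  rcases h1 with h | h | h | h <;> rw [h]
  · rw [c1]; norm_num
  · rw [c3]; norm_num; linear_combination (zeta 8 + zeta 8 ^ 3) * h4
  · rw [c5]; norm_num; linear_combination (zeta 8 + zeta 8 ^ 3) * h4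
  · rw [c7]; norm_num; ring

lemma chi_sq {i : ℕ} (hi : Odd i) : chi i * chi i = 1 := by
  have := Nat.odd_iff.1 hi
  rw [chi, ZMod.χ₈_nat_eq_if_mod_eight, if_neg (by omega)]
  split_ifs <;> simp

lemma chi_eq_or {i : ℕ} (hi : Odd i) : chi i = 1 ∨ chi i = -1 :=
  mul_self_eq_one_iff.1 (chi_sq hi)

lemma chi_add_mul_eight (i k : ℕ) : chi (i + 8 * k) = chi i := by
  rw [chi, chi]
  push_cast
  have : (8 : ZMod 8) = 0 := rfl
  rw [this, zero_mul, add_zero]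

lemma chi_congr {i j : ℕ} (h : i ≡ j [MOD 8]) : chi i = chi j := by
  rw [chi, chi, (ZMod.natCast_eq_natCast_iff i j 8).2 h]

end Eighth

/-! ### The Frobenius eigenvalues -/

section Eigenvalues

variable {F : Type*} [Field F] [Finite F] [CharP F 2]

lemma derivative_LStar (m : ℕ) (f : F[X]) : PowerSeries.derivative ℂ (LStar m f) =
    LStar m f * PowerSeries.mk fun n => expSumStar m f (n + 1) := by
  set c : ℂ := (((Real.sqrt 2 : ℝ) : ℂ) ^ m)⁻¹ with hc
  have h1 : PowerSeries.derivative ℂ (LStar m f) =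
      PowerSeries.C c * PowerSeries.rescale c (PowerSeries.derivative ℂ (LFun f)) := by
    ext n
    rw [LStar, PowerSeries.coeff_derivative, PowerSeries.coeff_C_mul, PowerSeries.coeff_rescale,
      PowerSeries.coeff_rescale, PowerSeries.coeff_derivative]
    ring
  rw [h1, derivative_LFun, map_mul, LStar, mul_left_comm]
  congr 1
  ext n
  rw [PowerSeries.coeff_C_mul, PowerSeries.coeff_rescale, PowerSeries.coeff_mk,
    PowerSeries.coeff_mk, expSumStar, pow_mul, hc]
  rw [inv_pow, div_eq_mul_inv, pow_succ _ n, mul_inv]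
  ring

lemma exists_LStar_eq_linProd {m : ℕ} (hF : Nat.card F = 2 ^ m) {d : ℕ} (hd : 1 ≤ d) {a : ℕ → F}
    (ha : a d ≠ 0) : ∃ W : Multiset ℂ, 0 ∉ W ∧
      LStar m (quadPoly d a) = (linProd W : PowerSeries ℂ) := by
  have : CharP (AlgebraicClosure F) 2 := charP_of_algebra F _
  let p : ℂ[X] := ∑ k ∈ Finset.range (2 ^ d + 1),
    C ((((Real.sqrt 2 : ℝ) : ℂ) ^ m)⁻¹ ^ k *
      (lCoeff (AlgebraicClosure F) m (quadPoly d a) k : ℂ)) * X ^ k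
  have hcoeff : ∀ k, p.coeff k = PowerSeries.coeff k (LStar m (quadPoly d a)) := by
    intro k
    rw [LStar, PowerSeries.coeff_rescale, coeff_LFun hF]
    simp only [p, finsetSum_coeff, coeff_C_mul_X_pow]
    rw [Finset.sum_ite_eq]
    split_ifs with h
    · rfl
    · rw [lCoeff_eq_zero hF hd ha (by simpa using h), Int.cast_zero, mul_zero]
  obtain ⟨W, hW, hp⟩ := exists_eq_linProd (p := p) (by
    rw [hcoeff, LStar, PowerSeries.coeff_rescale, coeff_zero_LFun, pow_zero, one_mul])
  refine ⟨W, hW, ?_⟩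
  rw [← hp]
  ext k
  rw [← hcoeff, coeff_coe]

/-- Comparison of the logarithmic derivatives of both expressions for `L^*`. -/
lemma expSumStar_eq_neg_sum {m : ℕ} {f : F[X]} {W : Multiset ℂ}
    (h : LStar m f = (linProd W : PowerSeries ℂ)) {n : ℕ} (hn : 1 ≤ n) :
    expSumStar m f n = -(W.map fun w => w ^ n).sum := by
  have h1 := derivative_LStar m f
  rw [h, derivative_linProd] at h1
  have h2 := mul_left_cancel₀ (by
    rw [Ne, Polynomial.coe_eq_zero_iff]; exact linProd_ne_zero W) h1
  have h3 := congrArg (PowerSeries.coeff (n - 1)) h2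
  rw [PowerSeries.coeff_mk, PowerSeries.coeff_mk, Nat.sub_add_cancel hn] at h3
  exact h3.symm

/-- The modified sums take finitely many values: their squares are zero or orders of subspaces of
the space of zeros of the kernel polynomial. -/
lemma finite_expSumStar {m : ℕ} (hF : Nat.card F = 2 ^ m) {d : ℕ} (hd : 1 ≤ d) {a : ℕ → F}
    (ha : a d ≠ 0) : ∃ V : Set ℂ, V.Finite ∧
      ∀ n, 1 ≤ n → expSumStar m (quadPoly d a) n ∈ V := by
  have : CharP (AlgebraicClosure F) 2 := charP_of_algebra F _
  refine ⟨⋃ w ∈ Finset.range ((kernelPoly d a).natDegree + 1), {z : ℂ | z ^ 2 = (w : ℂ)} ∪ {0},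
    ?_, fun n hn => ?_⟩
  · refine Set.Finite.biUnion (Finset.finite_toSet _) fun w _ =>
      Set.Finite.union ?_ (Set.finite_singleton 0)
    refine (Polynomial.nthRoots 2 (w : ℂ)).toFinset.finite_toSet.subset fun z hz => ?_
    rw [Finset.mem_coe, Multiset.mem_toFinset, mem_nthRoots two_pos]
    exact hz
  · obtain ⟨h, -⟩ := expSum_sq (K := AlgebraicClosure F) hF d a (Nat.one_le_iff_ne_zero.1 hn)
    simp only [Set.mem_iUnion]
    refine ⟨(radical (AlgebraicClosure F) d a (m * n)).card, ?_, ?_⟩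
    · rw [Finset.mem_range]
      exact Nat.lt_succ_of_le (card_radical_le hd ha _)
    · rcases h with h | h
      · right
        rw [expSumStar, h]; simp
      · left
        change _ ^ 2 = _
        have h2 : ((expSum (quadPoly d a) n : ℤ) : ℂ) ^ 2 =
            2 ^ (m * n) * ((radical (AlgebraicClosure F) d a (m * n)).card : ℂ) := by
          exact_mod_cast h
        have h3 : (2 : ℂ) ^ (m * n) ≠ 0 := pow_ne_zero _ two_ne_zero
        have h4 : (((Real.sqrt 2 : ℝ) : ℂ) ^ (m * n)) ^ 2 = 2 ^ (m * n) := by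
          rw [← pow_mul, mul_comm _ 2, pow_mul _ 2, sqrt_two_sq]
        rw [expSumStar, div_pow, h2, h4]
        field_simp

/-- The Galois action on the eigenvalues. Since `S_n = √2^{mn} S_n^*` is an integer and
`√2 = ζ_8 + ζ_8^7`, applying `ζ_P ↦ ζ_P^i` to the formula for `S_n^*` changes it by `χ(i)^n`. -/
lemma sum_pow_mul_eq_chi {m : ℕ} (hm : Odd m) {W : Multiset ℂ} {P : ℕ} (hP0 : P ≠ 0)
    (hP8 : 8 ∣ P) (hW : ∀ w ∈ W, w ^ P = 1) {S : ℕ → ℤ}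
    (hS : ∀ n, 1 ≤ n → (S n : ℂ) / ((Real.sqrt 2 : ℝ) : ℂ) ^ (m * n) =
      -(W.map fun w => w ^ n).sum) {i : ℕ} (hi : i.Coprime P) {n : ℕ} (hn : 1 ≤ n) :
    (W.map fun w => ((chi i : ℂ) * w ^ i) ^ n).sum = (W.map fun w => w ^ n).sum := by
  obtain ⟨Q, rfl⟩ := hP8
  have hQ0 : Q ≠ 0 := by rintro rfl; simp at hP0
  have : NeZero (8 * Q) := ⟨hP0⟩
  have hζ := zeta_isPrimitiveRoot hP0
  have hiodd : Odd i := by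
    rw [← Nat.coprime_two_right]
    exact Nat.Coprime.coprime_dvd_right ⟨4 * Q, by ring⟩ hi
  have hex : ∀ w ∈ W, ∃ e, zeta (8 * Q) ^ e = w := fun w hw => by
    obtain ⟨e, -, he⟩ := hζ.eq_pow_of_pow_eq_one (hW w hw)
    exact ⟨e, he⟩
  choose! e he using hex
  -- `G(ζ_P) = 0` is the formula for `S_n`, with `√2` written as `ζ_P^Q + ζ_P^{7Q}` and the
  -- eigenvalues as powers of `ζ_P`. The conjugates of `ζ_P` are zeros of `G` as well.
  let G : ℤ[X] := -(W.map fun w => X ^ (e w * n)).sum * (X ^ Q + X ^ (7 * Q)) ^ (m * n) - C (S n)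
  have hG : ∀ z : ℂ, aeval z G = -(W.map fun w => z ^ (e w * n)).sum *
      (z ^ Q + z ^ (7 * Q)) ^ (m * n) - S n := by
    intro z
    have h1 : aeval z (W.map fun w => (X : ℤ[X]) ^ (e w * n)).sum =
        (W.map fun w => z ^ (e w * n)).sum := by
      rw [map_multiset_sum, Multiset.map_map]
      simp
    simp [G, h1]
  have hz8 : zeta (8 * Q) ^ Q = zeta 8 := zeta_mul_pow (by norm_num) hQ0
  have hne : ((Real.sqrt 2 : ℝ) : ℂ) ^ (m * n) ≠ 0 := pow_ne_zero _ sqrt_two_ne_zero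
  have h0 : aeval (zeta (8 * Q)) G = 0 := by
    have h1 : (W.map fun w => zeta (8 * Q) ^ (e w * n)) = W.map fun w => w ^ n :=
      Multiset.map_congr rfl fun w hw => by rw [pow_mul, he w hw]
    rw [hG, h1, ← hS n hn, mul_comm 7 Q, pow_mul _ Q 7, hz8, zeta_eight_add]
    field_simp
    ring
  have h1 : aeval (zeta (8 * Q) ^ i) G = 0 := by
    have hdvd := minpoly.isIntegrallyClosed_dvd (hζ.isIntegral (Nat.pos_of_ne_zero hP0)) h0
    rw [hζ.minpoly_eq_pow_coprime hi] at hdvd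
    exact Polynomial.aeval_eq_zero_of_dvd_aeval_eq_zero hdvd (minpoly.aeval _ _)
  have h2 : (W.map fun w => (zeta (8 * Q) ^ i) ^ (e w * n)) = W.map fun w => (w ^ i) ^ n :=
    Multiset.map_congr rfl fun w hw => by
      rw [← he w hw]; simp only [← pow_mul]; congr 1; rw [he w hw]; ring
  have h3 : (zeta (8 * Q) ^ i) ^ Q + (zeta (8 * Q) ^ i) ^ (7 * Q) =
      chi i * ((Real.sqrt 2 : ℝ) : ℂ) := by
    rw [← zeta_eight_pow_add hiodd, ← hz8]
    simp only [← pow_mul]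
    congr 2 <;> ring
  rw [hG, h2, h3, mul_pow, sub_eq_zero] at h1
  have hχ : (chi i : ℂ) ^ (m * n) = (chi i : ℂ) ^ n := by
    rw [pow_mul]
    congr 1
    rcases chi_eq_or hiodd with h | h <;> rw [h]
    · simp
    · push_cast; exact hm.neg_one_pow
  have h4 := hS n hn
  rw [← h1, hχ] at h4
  have h5 : (W.map fun w => ((chi i : ℂ) * w ^ i) ^ n).sum =
      (chi i : ℂ) ^ n * (W.map fun w => (w ^ i) ^ n).sum := by
    simp_rw [mul_pow]
    rw [Multiset.sum_map_mul_left]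
  rw [h5]
  field_simp at h4
  linear_combination -h4

/-- The Galois action on the eigenvalues, read on multiplicities. -/
lemma count_chi_mul_pow [DecidableEq ℂ] {m : ℕ} (hm : Odd m) {W : Multiset ℂ} {P : ℕ}
    (hP0 : P ≠ 0) (hP8 : 8 ∣ P) (hW : ∀ w ∈ W, w ^ P = 1) {S : ℕ → ℤ}
    (hS : ∀ n, 1 ≤ n → (S n : ℂ) / ((Real.sqrt 2 : ℝ) : ℂ) ^ (m * n) =
      -(W.map fun w => w ^ n).sum) {i : ℕ} (hi : i.Coprime P) {w : ℂ} (hw : w ^ P = 1) :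
    W.count ((chi i : ℂ) * w ^ i) = W.count w := by
  have hiodd : Odd i := by
    rw [← Nat.coprime_two_right]
    exact Nat.Coprime.coprime_dvd_right ((by norm_num : 2 ∣ 8).trans hP8) hi
  have hχ0 : (chi i : ℂ) ≠ 0 := by
    rcases chi_eq_or hiodd with h | h <;> rw [h] <;> simp
  have hne : ∀ {z : ℂ}, z ^ P = 1 → z ≠ 0 := by
    rintro z hz rfl
    rw [zero_pow hP0] at hz
    exact zero_ne_one hz
  have hinj : ∀ z z' : ℂ, z ^ P = 1 → z' ^ P = 1 →
      (chi i : ℂ) * z ^ i = (chi i : ℂ) * z' ^ i → z = z' := by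
    intro z z' hz hz' h
    have h1 := mul_left_cancel₀ hχ0 h
    have hz'0 := hne hz'
    have h2 : (z / z') ^ i = 1 := by
      rw [div_pow, h1, div_self (pow_ne_zero _ hz'0)]
    have h3 : (z / z') ^ P = 1 := by rw [div_pow, hz, hz', div_one]
    have h4 := pow_gcd_eq_one.2 ⟨h2, h3⟩
    rw [Nat.Coprime.gcd_eq_one hi, pow_one] at h4
    exact (div_eq_one_iff_eq hz'0).1 h4
  have hmap : W.map (fun w => (chi i : ℂ) * w ^ i) = W := by
    refine multiset_eq_of_power_sums ?_ (fun h => hne (hW 0 h) rfl) fun n hn => ?_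
    · intro h
      obtain ⟨z, hz, hz0⟩ := Multiset.mem_map.1 h
      exact mul_ne_zero hχ0 (pow_ne_zero _ (hne (hW z hz))) hz0
    · rw [Multiset.map_map]
      exact sum_pow_mul_eq_chi hm hP0 hP8 hW hS hi hn
  by_cases hwW : w ∈ W
  · conv_lhs => rw [← hmap]
    exact Multiset.count_map_eq_count (fun w => (chi i : ℂ) * w ^ i) W
      (fun z hz z' hz' h => hinj z z' (hW z hz) (hW z' hz') h) w hwW
  · rw [Multiset.count_eq_zero_of_notMem hwW, Multiset.count_eq_zero]
    intro h
    rw [← hmap] at h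
    obtain ⟨z, hz, hzw⟩ := Multiset.mem_map.1 h
    rw [hinj z w (hW z hz) hw hzw] at hz
    exact hwW hz

/-- The multiset of normalized Frobenius eigenvalues: roots of unity of order dividing `P`, whose
multiplicities are invariant under `w ↦ χ(i) w^i` for `i` prime to `P`. -/
theorem exists_eigenvalues [DecidableEq ℂ] {m : ℕ} (hm : Odd m) (hF : Nat.card F = 2 ^ m) {d : ℕ}
    (hd : 1 ≤ d) {a : ℕ → F} (ha : a d ≠ 0) : ∃ (W : Multiset ℂ) (P : ℕ),
      LStar m (quadPoly d a) = (linProd W : PowerSeries ℂ) ∧ P ≠ 0 ∧ 8 ∣ P ∧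
      (∀ w ∈ W, w ^ P = 1) ∧
      (∀ n, 1 ≤ n → expSumStar m (quadPoly d a) n = -(W.map fun w => w ^ n).sum) ∧
      (∀ i, i.Coprime P → ∀ w : ℂ, w ^ P = 1 → W.count ((chi i : ℂ) * w ^ i) = W.count w) := by
  obtain ⟨W, hW0, hL⟩ := exists_LStar_eq_linProd hF hd ha
  have hsum : ∀ n, 1 ≤ n → expSumStar m (quadPoly d a) n = -(W.map fun w => w ^ n).sum :=
    fun n hn => expSumStar_eq_neg_sum hL hn
  obtain ⟨V, hV, hmem⟩ := finite_expSumStar hF hd ha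
  obtain ⟨P, hP, hWP⟩ := exists_pow_eq_one_of_finite hW0 (V := Neg.neg '' V) (hV.image _)
    (fun n hn => ⟨_, hmem n hn, by rw [hsum n hn, neg_neg]⟩)
  have hWP' : ∀ w ∈ W, w ^ (8 * P) = 1 := fun w hw => by
    rw [mul_comm, pow_mul, hWP w hw, one_pow]
  exact ⟨W, 8 * P, hL, by omega, dvd_mul_right 8 P, hWP', hsum, fun i hi w hw =>
    count_chi_mul_pow hm (by omega) (dvd_mul_right 8 P) hWP' hsum hi hw⟩

end Eigenvalues

/-! ### Indexing roots of unity by their order -/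

section RootsOfUnity

lemma mem_unitReps {l i : ℕ} : i ∈ unitReps l ↔ i < l ∧ i.Coprime l := by
  simp [unitReps]

lemma zeta_pow_isPrimitiveRoot {l i : ℕ} (hl : l ≠ 0) (hi : i.Coprime l) :
    IsPrimitiveRoot (zeta l ^ i) l :=
  (zeta_isPrimitiveRoot hl).pow_of_coprime i hi

lemma exists_zeta_pow_eq {w : ℂ} {P : ℕ} (hP : P ≠ 0) (hw : w ^ P = 1) :
    ∃ l i, l ≠ 0 ∧ l ∣ P ∧ i ∈ unitReps l ∧ zeta l ^ i = w := by
  have hpos : 0 < orderOf w := (isOfFinOrder_iff_pow_eq_one.2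
    ⟨P, Nat.pos_of_ne_zero hP, hw⟩).orderOf_pos
  have h := IsPrimitiveRoot.orderOf w
  have : NeZero (orderOf w) := ⟨hpos.ne'⟩
  obtain ⟨i, hi, hc, he⟩ := ((zeta_isPrimitiveRoot hpos.ne').isPrimitiveRoot_iff).1 h
  exact ⟨orderOf w, i, hpos.ne', orderOf_dvd_of_pow_eq_one hw, mem_unitReps.2 ⟨hi, hc⟩, he⟩

lemma zeta_pow_injOn {l : ℕ} (hl : l ≠ 0) {i j : ℕ} (hi : i ∈ unitReps l) (hj : j ∈ unitReps l)
    (h : zeta l ^ i = zeta l ^ j) : i = j :=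
  (zeta_isPrimitiveRoot hl).pow_inj (mem_unitReps.1 hi).1 (mem_unitReps.1 hj).1 h

lemma sum_primitiveRoots {l : ℕ} (hl : l ≠ 0) (g : ℂ → ℂ) :
    ∑ w ∈ primitiveRoots l ℂ, g w = ∑ i ∈ unitReps l, g (zeta l ^ i) := by
  symm
  have : NeZero l := ⟨hl⟩
  refine Finset.sum_bij (fun i _ => zeta l ^ i) ?_ (fun i hi j hj h => zeta_pow_injOn hl hi hj h)
    ?_ (fun _ _ => rfl)
  · intro i hi
    rw [mem_primitiveRoots (Nat.pos_of_ne_zero hl)]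
    exact zeta_pow_isPrimitiveRoot hl (mem_unitReps.1 hi).2
  · intro w hw
    rw [mem_primitiveRoots (Nat.pos_of_ne_zero hl),
      (zeta_isPrimitiveRoot hl).isPrimitiveRoot_iff] at hw
    obtain ⟨i, hi, hc, he⟩ := hw
    exact ⟨i, mem_unitReps.2 ⟨hi, hc⟩, he⟩

lemma sum_nthRootsFinset {k : ℕ} (hk : k ≠ 0) (g : ℂ → ℂ) :
    ∑ w ∈ nthRootsFinset k (1 : ℂ), g w =
      ∑ l ∈ k.divisors, ∑ i ∈ unitReps l, g (zeta l ^ i) := by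
  classical
  have : NeZero k := ⟨hk⟩
  rw [IsPrimitiveRoot.nthRoots_one_eq_biUnion_primitiveRoots, Finset.sum_biUnion]
  · refine Finset.sum_congr rfl fun l hl => sum_primitiveRoots ?_ g
    exact (Nat.pos_of_mem_divisors hl).ne'
  · intro l _ l' _ hne
    exact IsPrimitiveRoot.disjoint hne

lemma exists_coprime_modEq {l P i : ℕ} (hP : P ≠ 0) (hlP : l ∣ P) (hi : i.Coprime l) :
    ∃ j, j.Coprime P ∧ j ≡ i [MOD l] := by
  have : NeZero P := ⟨hP⟩
  obtain ⟨u, hu⟩ := ZMod.unitsMap_surjective hlP (ZMod.unitOfCoprime i hi)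
  refine ⟨(u : ZMod P).val, ZMod.val_coe_unit_coprime u, ?_⟩
  rw [← ZMod.natCast_eq_natCast_iff]
  have h := congrArg Units.val hu
  rw [ZMod.unitsMap_val, ZMod.coe_unitOfCoprime] at h
  rw [← h, ZMod.natCast_val]

lemma zeta_pow_congr {l i j : ℕ} (hl : l ≠ 0) (h : i ≡ j [MOD l]) : zeta l ^ i = zeta l ^ j := by
  have h1 := (zeta_isPrimitiveRoot hl).pow_eq_one
  rw [← Nat.div_add_mod i l, ← Nat.div_add_mod j l, pow_add, pow_add, pow_mul, pow_mul, h1,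
    one_pow, one_pow, h]

lemma chi_one_add_four_mul {k : ℕ} (hk : Odd k) : chi (1 + 4 * k) = -1 := by
  obtain ⟨j, rfl⟩ := hk
  have : 1 + 4 * (2 * j + 1) = 5 + 8 * j := by ring
  rw [this, chi_add_mul_eight]
  decide

lemma one_add_four_mul_coprime {v k : ℕ} : (1 + 4 * k).Coprime (2 ^ v * k) := by
  refine Nat.Coprime.mul_right (Nat.Coprime.pow_right v ?_) ?_
  · rw [Nat.coprime_two_right]
    exact ⟨2 * k, by ring⟩
  · rw [add_comm, Nat.coprime_mul_right_add_left]
    exact Nat.coprime_one_left k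

/-- For `8 ∣ ℓ`, the character `χ` takes the value `-1` on units modulo `ℓ`. -/
lemma exists_chi_eq_neg_one {l : ℕ} (hl : l ≠ 0) (h8 : 8 ∣ l) :
    ∃ i ∈ unitReps l, chi i = -1 := by
  obtain ⟨v, k, hk, rfl⟩ := Nat.exists_eq_two_pow_mul_odd hl
  refine ⟨1 + 4 * k, mem_unitReps.2 ⟨?_, one_add_four_mul_coprime⟩, chi_one_add_four_mul hk⟩
  have h1 : 8 ∣ 2 ^ v := by
    refine (Nat.Coprime.dvd_mul_right (k := 8) (n := k) ?_).1 h8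
    exact (Nat.coprime_two_left.2 hk).pow_left 3
  have h2 := Nat.le_of_dvd (Nat.two_pow_pos v) h1
  have := hk.pos
  nlinarith

lemma padicValNat_two_le_two_iff {l : ℕ} (hl : l ≠ 0) : padicValNat 2 l ≤ 2 ↔ ¬ 8 ∣ l := by
  have h := padicValNat_dvd_iff_le (p := 2) hl (n := 3)
  norm_num at h
  omega

end RootsOfUnity

/-! ### The quadratic Gauss sum modulo `8` -/

section Gauss

lemma card_unitReps (l : ℕ) : (unitReps l).card = l.totient := by
  rw [unitReps, Nat.totient]
  simp_rw [Nat.coprime_comm]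

lemma unitReps_eight : unitReps 8 = {1, 3, 5, 7} := by decide

/-- The quadratic Gauss sum of the conductor `8`, twisted by an odd `n`. -/
lemma sum_chi_zeta_eight {n : ℕ} (hn : Odd n) :
    ∑ u ∈ unitReps 8, (chi u : ℂ) * zeta 8 ^ (n * u) =
      2 * ((Real.sqrt 2 : ℝ) : ℂ) * chi n := by
  have h4 : (zeta 8 ^ n) ^ 4 = -1 := by
    rw [← pow_mul, mul_comm, pow_mul, zeta_eight_pow_four, hn.neg_one_pow]
  have h1 := zeta_eight_pow_add hn
  rw [mul_comm 7 n, pow_mul] at h1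
  have c1 : chi 1 = 1 := by decide
  have c3 : chi 3 = -1 := by decide
  have c5 : chi 5 = -1 := by decide
  have c7 : chi 7 = 1 := by decide
  rw [unitReps_eight]
  simp only [pow_mul]
  rw [Finset.sum_insert (by decide), Finset.sum_insert (by decide), Finset.sum_insert (by decide),
    Finset.sum_singleton, c1, c3, c5, c7]
  push_cast
  linear_combination 2 * h1 - (zeta 8 ^ n + (zeta 8 ^ n) ^ 3) * h4

/-- Splitting a unit modulo `8k`, `k` odd, into its components modulo `8` and `k`. -/
lemma sum_chi_zeta_eight_mul {k n : ℕ} (hk : Odd k) (hn : Odd n) :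
    ∑ i ∈ unitReps (8 * k), (chi i : ℂ) * zeta (8 * k) ^ (n * i) =
      2 * ((Real.sqrt 2 : ℝ) : ℂ) * (chi n * ramanujanSum k n * chi k) := by
  classical
  have hk0 : k ≠ 0 := hk.pos.ne'
  have h8k : Nat.Coprime 8 k := (Nat.coprime_two_left.2 hk).pow_left 3
  -- The parametrization for which `ζ_{8k}^{uk + 8w} = ζ_8^u ζ_k^w`.
  let g : ℕ × ℕ → ℕ := fun b => (b.1 * k + 8 * b.2) % (8 * k)
  have hg8 : ∀ b, g b ≡ b.1 * k [MOD 8] := fun b => by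
    have h1 : g b ≡ b.1 * k + 8 * b.2 [MOD 8] :=
      (Nat.mod_modEq _ _).of_mul_right k
    refine h1.trans ?_
    simp [Nat.ModEq]
  have hgk : ∀ b, g b ≡ 8 * b.2 [MOD k] := fun b => by
    have h1 : g b ≡ b.1 * k + 8 * b.2 [MOD k] :=
      (Nat.mod_modEq _ _).of_mul_left 8
    refine h1.trans ?_
    simp [Nat.ModEq]
  have hinj : ∀ b ∈ unitReps 8 ×ˢ unitReps k, ∀ b' ∈ unitReps 8 ×ˢ unitReps k,
      g b = g b' → b = b' := by
    rintro ⟨u, w⟩ hb ⟨u', w'⟩ hb' h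
    obtain ⟨hu, hw⟩ := Finset.mem_product.1 hb
    obtain ⟨hu', hw'⟩ := Finset.mem_product.1 hb'
    have h1 : u * k ≡ u' * k [MOD 8] := (hg8 (u, w)).symm.trans (by rw [h]; exact hg8 (u', w'))
    have h2 : 8 * w ≡ 8 * w' [MOD k] := (hgk (u, w)).symm.trans (by rw [h]; exact hgk (u', w'))
    have h3 := Nat.ModEq.cancel_right_of_coprime h8k h1
    have h4 := Nat.ModEq.cancel_left_of_coprime h8k.symm h2
    rw [Nat.ModEq, Nat.mod_eq_of_lt (mem_unitReps.1 hu).1,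
      Nat.mod_eq_of_lt (mem_unitReps.1 hu').1] at h3
    rw [Nat.ModEq, Nat.mod_eq_of_lt (mem_unitReps.1 hw).1,
      Nat.mod_eq_of_lt (mem_unitReps.1 hw').1] at h4
    exact Prod.ext h3 h4
  have himg : (unitReps 8 ×ˢ unitReps k).image g = unitReps (8 * k) := by
    refine Finset.eq_of_subset_of_card_le ?_ ?_
    · intro i hi
      obtain ⟨⟨u, w⟩, hb, rfl⟩ := Finset.mem_image.1 hi
      obtain ⟨hu, hw⟩ := Finset.mem_product.1 hb
      rw [mem_unitReps]
      refine ⟨Nat.mod_lt _ (by positivity), Nat.Coprime.mul_right ?_ ?_⟩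
      · rw [Nat.Coprime, (hg8 (u, w)).gcd_eq]
        exact Nat.Coprime.mul_left (mem_unitReps.1 hu).2 h8k.symm
      · rw [Nat.Coprime, (hgk (u, w)).gcd_eq]
        exact Nat.Coprime.mul_left h8k (mem_unitReps.1 hw).2
    · rw [Finset.card_image_of_injOn hinj, Finset.card_product, card_unitReps, card_unitReps,
        card_unitReps, Nat.totient_mul h8k]
  have hterm : ∀ b ∈ unitReps 8 ×ˢ unitReps k,
      (chi (g b) : ℂ) * zeta (8 * k) ^ (n * g b) =
        chi k * ((chi b.1 * zeta 8 ^ (n * b.1)) * zeta k ^ (n * b.2)) := by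
    rintro ⟨u, w⟩ hb
    have h1 : zeta (8 * k) ^ (n * g (u, w)) = zeta (8 * k) ^ (n * (u * k + 8 * w)) :=
      zeta_pow_congr (by positivity) ((Nat.mod_modEq _ _).mul_left n)
    have h2 : n * (u * k + 8 * w) = k * (n * u) + 8 * (n * w) := by ring
    have h3 : zeta (8 * k) ^ 8 = zeta k := by
      rw [mul_comm]; exact zeta_mul_pow hk0 (by norm_num)
    rw [h1, h2, pow_add, pow_mul _ k, pow_mul _ 8, zeta_mul_pow (by norm_num) hk0, h3,
      chi_congr (hg8 (u, w)), chi_mul]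
    push_cast; ring
  rw [← himg, Finset.sum_image hinj, Finset.sum_congr rfl hterm, ← Finset.mul_sum,
    Finset.sum_product]
  dsimp only
  rw [← Finset.sum_mul_sum, sum_chi_zeta_eight hn, ramanujanSum]
  ring

end Gauss

/-! ### The product attached to a system of multiplicities -/

section ToPoly

lemma linProd_nsmul (n : ℕ) (W : Multiset ℂ) : linProd (n • W) = linProd W ^ n := by
  simp [linProd, Multiset.map_nsmul, Multiset.prod_nsmul]

lemma linProd_sum {ι : Type*} (T : Finset ι) (g : ι → Multiset ℂ) :
    linProd (∑ i ∈ T, g i) = ∏ i ∈ T, linProd (g i) := by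
  classical
  induction T using Finset.induction_on with
  | empty => simp [linProd]
  | insert a T ha ih => rw [Finset.sum_insert ha, Finset.prod_insert ha, linProd_add, ih]

/-- The multiset of the `ζ_ℓ^i`, for `ℓ` with property `p` and `i ∈ A ℓ`, with multiplicity
`c ℓ`. -/
def cycMultiset (p : ℕ → Prop) [DecidablePred p] (A : ℕ → Finset ℕ) (c : ℕ →₀ ℕ) : Multiset ℂ :=
  ∑ l ∈ c.support.filter p, c l • (A l).val.map fun i => zeta l ^ i

lemma linProd_cycMultiset (p : ℕ → Prop) [DecidablePred p] (A : ℕ → Finset ℕ) (c : ℕ →₀ ℕ) :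
    linProd (cycMultiset p A c) =
      ∏ l ∈ c.support.filter p, (∏ i ∈ A l, (1 - C (zeta l ^ i) * X)) ^ c l := by
  rw [cycMultiset, linProd_sum]
  refine Finset.prod_congr rfl fun l _ => ?_
  rw [linProd_nsmul, linProd, Multiset.map_map]
  rfl

lemma mem_cycMultiset {p : ℕ → Prop} [DecidablePred p] {A : ℕ → Finset ℕ} {c : ℕ →₀ ℕ} {w : ℂ}
    (hw : w ∈ cycMultiset p A c) : ∃ l, p l ∧ ∃ i ∈ A l, zeta l ^ i = w := by
  obtain ⟨l, hl, h⟩ := Multiset.mem_sum.1 hw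
  obtain ⟨i, hi, rfl⟩ := Multiset.mem_map.1 (Multiset.mem_of_mem_nsmul h)
  exact ⟨l, (Finset.mem_filter.1 hl).2, i, hi, rfl⟩

lemma count_cycMultiset [DecidableEq ℂ] {p : ℕ → Prop} [DecidablePred p] (hp : ∀ l, p l → l ≠ 0)
    {A : ℕ → Finset ℕ} (hA : ∀ l, A l ⊆ unitReps l) (c : ℕ →₀ ℕ) {l i : ℕ} (hl : l ≠ 0)
    (hi : i ∈ unitReps l) :
    (cycMultiset p A c).count (zeta l ^ i) = if p l ∧ i ∈ A l then c l else 0 := by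
  have hcount : ∀ l', l' ≠ 0 → ((A l').val.map fun j => zeta l' ^ j).count (zeta l ^ i) =
      if l' = l ∧ i ∈ A l then 1 else 0 := by
    intro l' hl'
    have hnd : ((A l').val.map fun j => zeta l' ^ j).Nodup :=
      Multiset.Nodup.map_on (fun j hj k hk h => zeta_pow_injOn hl' (hA l' hj) (hA l' hk) h)
        (A l').nodup
    rw [Multiset.count_eq_of_nodup hnd]
    refine if_congr ?_ rfl rfl
    rw [Multiset.mem_map]
    constructor
    · rintro ⟨j, hj, h⟩
      have hll : l' = l := by
        have h1 := zeta_pow_isPrimitiveRoot hl' (mem_unitReps.1 (hA l' hj)).2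
        rw [h] at h1
        exact h1.unique (zeta_pow_isPrimitiveRoot hl (mem_unitReps.1 hi).2)
      subst hll
      rw [zeta_pow_injOn hl hi (hA l' hj) h.symm]
      exact ⟨rfl, hj⟩
    · rintro ⟨rfl, h⟩
      exact ⟨i, h, rfl⟩
  rw [cycMultiset, Multiset.count_sum']
  have h1 : ∀ l' ∈ c.support.filter p,
      (c l' • (A l').val.map fun j => zeta l' ^ j).count (zeta l ^ i) =
        if l' = l then (if i ∈ A l then c l else 0) else 0 := by
    intro l' hl'
    rw [Multiset.count_nsmul, hcount l' (hp l' (Finset.mem_filter.1 hl').2)]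
    by_cases h : l' = l
    · subst h
      by_cases h' : i ∈ A l' <;> simp [h']
    · simp [h]
  rw [Finset.sum_congr rfl h1, Finset.sum_ite_eq']
  by_cases hpl : p l <;> by_cases hc : c l = 0 <;> simp [hpl, hc]

/-- The multiset of roots of unity attached to a system of multiplicities. -/
def Multiplicities.toMultiset (M : Multiplicities) : Multiset ℂ :=
  cycMultiset (fun l => 1 ≤ l ∧ padicValNat 2 l ≤ 2) unitReps M.m +
  cycMultiset (fun l => 1 ≤ l ∧ 3 ≤ padicValNat 2 l)
    (fun l => (unitReps l).filter fun i => chi i = 1) M.mPlus +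
  cycMultiset (fun l => 1 ≤ l ∧ 3 ≤ padicValNat 2 l)
    (fun l => (unitReps l).filter fun i => chi i = -1) M.mMinus

lemma Multiplicities.toPoly_eq_linProd (M : Multiplicities) : M.toPoly = linProd M.toMultiset := by
  rw [toMultiset, linProd_add, linProd_add, linProd_cycMultiset, linProd_cycMultiset,
    linProd_cycMultiset]
  rfl

lemma Multiplicities.exists_of_mem_toMultiset {M : Multiplicities} {w : ℂ}
    (hw : w ∈ M.toMultiset) : ∃ l i, l ≠ 0 ∧ i ∈ unitReps l ∧ zeta l ^ i = w := by
  rw [toMultiset, Multiset.mem_add, Multiset.mem_add] at hw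
  rcases hw with (h | h) | h
  · obtain ⟨l, hl, i, hi, h⟩ := mem_cycMultiset h
    exact ⟨l, i, Nat.one_le_iff_ne_zero.1 hl.1, hi, h⟩
  · obtain ⟨l, hl, i, hi, h⟩ := mem_cycMultiset h
    exact ⟨l, i, Nat.one_le_iff_ne_zero.1 hl.1, (Finset.mem_filter.1 hi).1, h⟩
  · obtain ⟨l, hl, i, hi, h⟩ := mem_cycMultiset h
    exact ⟨l, i, Nat.one_le_iff_ne_zero.1 hl.1, (Finset.mem_filter.1 hi).1, h⟩

lemma Multiplicities.zero_notMem_toMultiset (M : Multiplicities) : 0 ∉ M.toMultiset := by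
  intro h
  obtain ⟨l, i, hl, -, h0⟩ := exists_of_mem_toMultiset h
  exact pow_ne_zero i ((zeta_isPrimitiveRoot hl).ne_zero hl) h0

lemma odd_of_mem_unitReps {l i : ℕ} (h8 : 8 ∣ l) (hi : i ∈ unitReps l) : Odd i := by
  rw [← Nat.coprime_two_right]
  exact Nat.Coprime.coprime_dvd_right ((by norm_num : 2 ∣ 8).trans h8) (mem_unitReps.1 hi).2

lemma Multiplicities.count_toMultiset [DecidableEq ℂ] (M : Multiplicities) {l i : ℕ} (hl : l ≠ 0)
    (hi : i ∈ unitReps l) : M.toMultiset.count (zeta l ^ i) =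
      if 8 ∣ l then (if chi i = 1 then M.mPlus l else M.mMinus l) else M.m l := by
  have hp := padicValNat_two_le_two_iff hl
  have h1l : 1 ≤ l := Nat.one_le_iff_ne_zero.2 hl
  rw [toMultiset, Multiset.count_add, Multiset.count_add,
    count_cycMultiset (fun l h => Nat.one_le_iff_ne_zero.1 h.1) (fun l => subset_rfl) _ hl hi,
    count_cycMultiset (fun l h => Nat.one_le_iff_ne_zero.1 h.1)
      (fun l => Finset.filter_subset _ _) _ hl hi,
    count_cycMultiset (fun l h => Nat.one_le_iff_ne_zero.1 h.1)
      (fun l => Finset.filter_subset _ _) _ hl hi]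
  by_cases h8 : 8 ∣ l
  · have h2 : ¬ padicValNat 2 l ≤ 2 := fun h => hp.1 h h8
    have h3 : 3 ≤ padicValNat 2 l := by omega
    rcases chi_eq_or (odd_of_mem_unitReps h8 hi) with h | h <;>
      simp [h2, h3, h8, h, hi, h1l]
  · have h2 : padicValNat 2 l ≤ 2 := hp.2 h8
    have h3 : ¬ 3 ≤ padicValNat 2 l := by omega
    simp [h2, h3, h8, hi, h1l]

end ToPoly

/-! ### Multisets of roots of unity with the twisted Galois symmetry -/

section Symmetric

/-- The multiplicity of `w` in `W` is invariant under `w ↦ χ(i) w^i` on the roots of unity of order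
dividing `P`, the elements of `W` being such roots of unity and `8 ∣ P`. -/
structure IsTwistedStable [DecidableEq ℂ] (P : ℕ) (W : Multiset ℂ) : Prop where
  ne_zero : P ≠ 0
  eight_dvd : 8 ∣ P
  pow_eq_one : ∀ w ∈ W, w ^ P = 1
  count_eq : ∀ i, i.Coprime P → ∀ w : ℂ, w ^ P = 1 → W.count ((chi i : ℂ) * w ^ i) = W.count w

variable [DecidableEq ℂ] {P : ℕ} {W : Multiset ℂ}

lemma IsTwistedStable.even (h : IsTwistedStable P W) : Even P :=
  even_iff_two_dvd.2 ((by norm_num : 2 ∣ 8).trans h.eight_dvd)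

lemma IsTwistedStable.zero_notMem (h : IsTwistedStable P W) : 0 ∉ W := fun h0 => by
  have := h.pow_eq_one 0 h0
  rw [zero_pow h.ne_zero] at this
  exact zero_ne_one this

lemma IsTwistedStable.count_eq_zero (h : IsTwistedStable P W) {l i : ℕ} (hl : l ≠ 0)
    (hi : i.Coprime l) (hlP : ¬ l ∣ P) :
    W.count (zeta l ^ i) = 0 ∧ W.count (-(zeta l ^ i)) = 0 := by
  have h1 : (zeta l ^ i) ^ P ≠ 1 := fun h1 =>
    hlP ((zeta_pow_isPrimitiveRoot hl hi).dvd_of_pow_eq_one P h1)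
  refine ⟨Multiset.count_eq_zero.2 fun hw => h1 (h.pow_eq_one _ hw),
    Multiset.count_eq_zero.2 fun hw => h1 ?_⟩
  have := h.pow_eq_one _ hw
  rwa [h.even.neg_pow] at this

/-- If `8 ∣ ℓ`, the multiplicities of the primitive `ℓ`-th roots of unity `ζ_ℓ^i` only depend
on `χ(i)`, and passing from `χ(i) = 1` to `χ(i) = -1` amounts to changing the sign of the root. -/
lemma IsTwistedStable.count_zeta_pow (h : IsTwistedStable P W) {l i : ℕ} (hl : l ≠ 0)
    (h8 : 8 ∣ l) (hi : i.Coprime l) :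
    W.count ((chi i : ℂ) * zeta l ^ i) = W.count (zeta l) ∧
      W.count (-((chi i : ℂ) * zeta l ^ i)) = W.count (-zeta l) := by
  have hiodd : Odd i := by
    rw [← Nat.coprime_two_right]
    exact Nat.Coprime.coprime_dvd_right ((by norm_num : 2 ∣ 8).trans h8) hi
  by_cases hlP : l ∣ P
  · obtain ⟨j, hj, hji⟩ := exists_coprime_modEq h.ne_zero hlP hi
    have h1 : zeta l ^ P = 1 := by
      obtain ⟨c, rfl⟩ := hlP
      rw [pow_mul, (zeta_isPrimitiveRoot hl).pow_eq_one, one_pow]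
    have hjodd : Odd j := by
      rw [← Nat.coprime_two_right]
      exact Nat.Coprime.coprime_dvd_right (even_iff_two_dvd.1 h.even) hj
    have h2 := h.count_eq j hj (zeta l) h1
    have h3 := h.count_eq j hj (-zeta l) (by rw [h.even.neg_pow, h1])
    rw [hjodd.neg_pow, mul_neg] at h3
    rw [zeta_pow_congr hl hji, chi_congr (hji.of_dvd h8)] at h2 h3
    exact ⟨h2, h3⟩
  · have h1 := h.count_eq_zero hl hi hlP
    have h2 := h.count_eq_zero hl (Nat.coprime_one_left l) hlP
    rw [pow_one] at h2
    rcases chi_eq_or hiodd with hc | hc <;> rw [hc] <;> simp [h1, h2]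

/-- If `8 ∤ ℓ`, the primitive `ℓ`-th roots of unity and their opposites all have the same
multiplicity: the Galois group of `ℚ(ζ_ℓ, √2)` contains an element that fixes `ζ_ℓ` and not `√2`. -/
lemma IsTwistedStable.count_zeta_pow_of_not_dvd (h : IsTwistedStable P W) {l i : ℕ} (hl : l ≠ 0)
    (h8 : ¬ 8 ∣ l) (hi : i.Coprime l) :
    W.count (zeta l ^ i) = W.count (zeta l) ∧ W.count (-(zeta l ^ i)) = W.count (zeta l ^ i) := by
  by_cases hlP : l ∣ P
  · have h1 : zeta l ^ P = 1 := by
      obtain ⟨c, rfl⟩ := hlP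
      rw [pow_mul, (zeta_isPrimitiveRoot hl).pow_eq_one, one_pow]
    have hneg : W.count (-(zeta l ^ i)) = W.count (zeta l ^ i) := by
      obtain ⟨v, k, hk, hP⟩ := Nat.exists_eq_two_pow_mul_odd h.ne_zero
      -- Raising to the power `1 + 4k` fixes `ζ_ℓ`, since `ℓ ∣ 4k`, while `χ(1 + 4k) = -1`.
      have hl4 : l ∣ 4 * k := by
        obtain ⟨v', k', hk', rfl⟩ := Nat.exists_eq_two_pow_mul_odd hl
        rw [hP] at hlP
        refine Nat.mul_dvd_mul ?_ ?_
        · have hv' : v' ≤ 2 := by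
            by_contra hv'
            exact h8 ((pow_dvd_pow 2 (by omega : 3 ≤ v')).trans (dvd_mul_right _ _))
          exact pow_dvd_pow 2 hv'
        · exact (Nat.Coprime.dvd_mul_left ((Nat.coprime_two_right.2 hk').pow_right v)).1
            ((dvd_mul_left _ _).trans hlP)
      have h2 := h.count_eq (1 + 4 * k) (by rw [hP]; exact one_add_four_mul_coprime) (zeta l ^ i)
        (by rw [← pow_mul, mul_comm, pow_mul, h1, one_pow])
      rw [chi_one_add_four_mul hk] at h2
      have h3 : (zeta l ^ i) ^ (1 + 4 * k) = zeta l ^ i := by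
        obtain ⟨c, hc⟩ := hl4
        rw [pow_add, hc, pow_mul, ← pow_mul _ i l, mul_comm i l, pow_mul,
          (zeta_isPrimitiveRoot hl).pow_eq_one, one_pow, one_pow, pow_one, mul_one]
      rw [h3] at h2
      push_cast at h2
      rwa [neg_one_mul] at h2
    refine ⟨?_, hneg⟩
    obtain ⟨j, hj, hji⟩ := exists_coprime_modEq h.ne_zero hlP hi
    have h2 := h.count_eq j hj (zeta l) h1
    have hjodd : Odd j := by
      rw [← Nat.coprime_two_right]
      exact Nat.Coprime.coprime_dvd_right (even_iff_two_dvd.1 h.even) hj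
    rw [zeta_pow_congr hl hji] at h2
    rcases chi_eq_or hjodd with hc | hc <;> rw [hc] at h2
    · simpa using h2
    · rw [← hneg, ← h2]; simp
  · have h1 := h.count_eq_zero hl hi hlP
    have h2 := h.count_eq_zero hl (Nat.coprime_one_left l) hlP
    rw [pow_one] at h2
    rw [h1.1, h1.2, h2.1]
    exact ⟨rfl, rfl⟩

/-- If `16 ∣ ℓ`, then `-ζ_ℓ = ζ_ℓ^i` with `i = 1 + ℓ/2` and `χ(i) = 1`. -/
lemma IsTwistedStable.count_neg_zeta (h : IsTwistedStable P W) {l : ℕ} (hl : l ≠ 0)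
    (h16 : 16 ∣ l) : W.count (-zeta l) = W.count (zeta l) := by
  obtain ⟨k, rfl⟩ := h16
  have hk : k ≠ 0 := by rintro rfl; simp at hl
  have hcop : (1 + 8 * k).Coprime (16 * k) := by
    have h1 : (1 + 8 * k).Coprime k := by
      rw [add_comm, Nat.coprime_mul_right_add_left]
      exact Nat.coprime_one_left k
    have h2 : (1 + 8 * k).Coprime (2 ^ 4) := by
      refine Nat.Coprime.pow_right 4 ?_
      rw [Nat.coprime_two_right]
      exact ⟨4 * k, by ring⟩
    exact Nat.Coprime.mul_right h2 h1
  have h1 := (h.count_zeta_pow hl ⟨2 * k, by ring⟩ hcop).1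
  rw [chi_add_mul_eight] at h1
  have h2 : zeta (16 * k) ^ (1 + 8 * k) = -zeta (16 * k) := by
    have h3 : zeta (16 * k) ^ (8 * k) = -1 := by
      have h4 := zeta_mul_pow (l := 2) (k := 8 * k) (by norm_num) (by omega)
      have h5 : 2 * (8 * k) = 16 * k := by ring
      rw [h5] at h4
      rw [h4]
      exact (zeta_isPrimitiveRoot (by norm_num)).eq_neg_one_of_two_right
    rw [pow_add, h3, pow_one, mul_neg, mul_one]
  have hc : chi 1 = 1 := by decide
  rw [h2, hc] at h1
  simpa using h1

/-- A stable multiset comes from a system of multiplicities. -/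
lemma IsTwistedStable.exists_multiplicities (h : IsTwistedStable P W) :
    ∃ M : Multiplicities, M.toMultiset = W := by
  have hdvd : ∀ l, l ≠ 0 → ¬ l ∣ P → W.count (zeta l) = 0 ∧ W.count (-zeta l) = 0 := by
    intro l hl hlP
    have := h.count_eq_zero hl (Nat.coprime_one_left l) hlP
    rwa [pow_one] at this
  let c : ℕ →₀ ℕ := Finsupp.onFinset P.divisors
    (fun l => if l = 0 then 0 else W.count (zeta l)) (fun l hl => by
      rw [Nat.mem_divisors]
      by_contra hlP
      have hl0 : l ≠ 0 := by rintro rfl; simp at hl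
      rw [if_neg hl0] at hl
      exact hl (hdvd l hl0 fun h' => hlP ⟨h', h.ne_zero⟩).1)
  let c' : ℕ →₀ ℕ := Finsupp.onFinset P.divisors
    (fun l => if l = 0 then 0 else W.count (-zeta l)) (fun l hl => by
      rw [Nat.mem_divisors]
      by_contra hlP
      have hl0 : l ≠ 0 := by rintro rfl; simp at hl
      rw [if_neg hl0] at hl
      exact hl (hdvd l hl0 fun h' => hlP ⟨h', h.ne_zero⟩).2)
  refine ⟨⟨c, c, c'⟩, ?_⟩
  -- `m_ℓ` and `m_ℓ^+` are the multiplicity of `ζ_ℓ`, and `m_ℓ^-` is that of `-ζ_ℓ`.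
  have key : ∀ l i, l ≠ 0 → i ∈ unitReps l →
      (Multiplicities.mk c c c').toMultiset.count (zeta l ^ i) = W.count (zeta l ^ i) := by
    intro l i hl hi
    have hc : c l = W.count (zeta l) := if_neg hl
    have hc' : c' l = W.count (-zeta l) := if_neg hl
    rw [Multiplicities.count_toMultiset _ hl hi]
    dsimp only
    rw [hc, hc']
    split_ifs with h8 hχ
    · have := (h.count_zeta_pow hl h8 (mem_unitReps.1 hi).2).1
      rw [hχ] at this
      rw [← this]; simp
    · have := (h.count_zeta_pow hl h8 (mem_unitReps.1 hi).2).2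
      rw [(chi_eq_or (odd_of_mem_unitReps h8 hi)).resolve_left hχ] at this
      rw [← this]; simp
    · exact (h.count_zeta_pow_of_not_dvd hl h8 (mem_unitReps.1 hi).2).1.symm
  ext w
  by_cases hw : w ∈ W
  · obtain ⟨l, i, hl, -, hi, rfl⟩ := exists_zeta_pow_eq h.ne_zero (h.pow_eq_one w hw)
    exact key l i hl hi
  · by_cases hw' : w ∈ (Multiplicities.mk c c c').toMultiset
    · obtain ⟨l, i, hl, hi, rfl⟩ := Multiplicities.exists_of_mem_toMultiset hw'
      exact key l i hl hi
    · rw [Multiset.count_eq_zero_of_notMem hw, Multiset.count_eq_zero_of_notMem hw']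

/-- The negative multiplicities measure the asymmetry of the multiset under `w ↦ -w`. -/
lemma IsTwistedStable.neg_eq {M : Multiplicities} (h : IsTwistedStable P M.toMultiset) {l : ℕ}
    (hl : l ≠ 0) : M.neg l =
      if 8 ∣ l then ((M.toMultiset.count (zeta l) : ℚ) - M.toMultiset.count (-zeta l)) / 2
        else 0 := by
  rw [Multiplicities.neg]
  by_cases h8 : 8 ∣ l
  · rw [if_neg (fun h' => (padicValNat_two_le_two_iff hl).1 h' h8), if_pos h8]
    have h1mem : 1 ∈ unitReps l := mem_unitReps.2
      ⟨by have := Nat.le_of_dvd (Nat.pos_of_ne_zero hl) h8; omega, Nat.coprime_one_left l⟩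
    obtain ⟨i, hi, hχ⟩ := exists_chi_eq_neg_one hl h8
    have h1 := M.count_toMultiset hl h1mem
    have h2 := M.count_toMultiset hl hi
    have h3 := (h.count_zeta_pow hl h8 (mem_unitReps.1 hi).2).2
    rw [if_pos h8, if_pos (by decide), pow_one] at h1
    rw [if_pos h8, if_neg (by rw [hχ]; decide)] at h2
    rw [hχ] at h3
    push_cast at h3
    rw [neg_one_mul, neg_neg, h2] at h3
    rw [h1, h3]
  · rw [if_pos ((padicValNat_two_le_two_iff hl).2 h8), if_neg h8]

end Symmetric

/-! ### The negative multiplicities -/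

section Negative

variable [DecidableEq ℂ] {P : ℕ} {W : Multiset ℂ}

/-- The asymmetry of `W` under `w ↦ -w` only sees the power sums of odd order. -/
lemma sum_sub_count_neg {Z : Finset ℂ}
    (hZ : W.toFinset ⊆ Z) (hneg : ∀ w ∈ Z, -w ∈ Z) (n : ℕ) :
    ∑ w ∈ Z, ((W.count w : ℂ) - W.count (-w)) * w ^ n =
      (1 - (-1) ^ n) * (W.map fun w => w ^ n).sum := by
  have h1 : ∑ w ∈ Z, (W.count (-w) : ℂ) * w ^ n = ∑ w ∈ Z, (W.count w : ℂ) * (-w) ^ n :=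
    Finset.sum_bij' (fun w _ => -w) (fun w _ => -w) hneg hneg (fun w _ => neg_neg w)
      (fun w _ => neg_neg w) (fun w _ => by rw [neg_neg])
  have h2 : ∑ w ∈ Z, ((W.count w : ℂ) - W.count (-w)) * w ^ n =
      ∑ w ∈ Z, (W.count w : ℂ) * w ^ n - ∑ w ∈ Z, (W.count (-w) : ℂ) * w ^ n := by
    rw [← Finset.sum_sub_distrib]
    exact Finset.sum_congr rfl fun w _ => by ring
  rw [h2, h1, sum_map_eq_sum_count W hZ, Finset.mul_sum, ← Finset.sum_sub_distrib]
  refine Finset.sum_congr rfl fun w _ => ?_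
  rw [neg_pow w]; ring

/-- If the power sums of odd order are periodic with even period `k`, then the asymmetry of `W`
under `w ↦ -w` is supported on roots of unity of order dividing `k`. -/
lemma IsTwistedStable.count_neg_eq_of_periodic (h : IsTwistedStable P W) {k : ℕ} (hk : Even k)
    (hper : ∀ n, Odd n → (W.map fun w => w ^ (n + k)).sum = (W.map fun w => w ^ n).sum) {w : ℂ}
    (hwk : w ^ k ≠ 1) : W.count (-w) = W.count w := by
  set Z := W.toFinset ∪ W.toFinset.image Neg.neg with hZdef
  have hneg : ∀ w ∈ Z, -w ∈ Z := by
    intro w hw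
    rcases Finset.mem_union.1 hw with hw | hw
    · exact Finset.mem_union_right _ (Finset.mem_image_of_mem _ hw)
    · obtain ⟨z, hz, rfl⟩ := Finset.mem_image.1 hw
      rw [neg_neg]
      exact Finset.mem_union_left _ hz
  have hsub : W.toFinset ⊆ Z := Finset.subset_union_left
  by_cases hwZ : w ∈ Z
  · have hw0 : w ≠ 0 := by
      rintro rfl
      rcases Finset.mem_union.1 hwZ with hw | hw
      · exact h.zero_notMem (Multiset.mem_toFinset.1 hw)
      · obtain ⟨z, hz, hz0⟩ := Finset.mem_image.1 hw
        rw [neg_eq_zero] at hz0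
        rw [hz0] at hz
        exact h.zero_notMem (Multiset.mem_toFinset.1 hz)
    have key := eq_zero_of_sum_mul_pow_eq_zero Z
      (fun w => ((W.count w : ℂ) - W.count (-w)) * (w ^ k - 1)) (fun j _ => by
        have h1 := sum_sub_count_neg hsub hneg (j + k)
        have h2 := sum_sub_count_neg hsub hneg j
        have h3 : ∑ w ∈ Z, ((W.count w : ℂ) - W.count (-w)) * (w ^ k - 1) * w ^ j =
            ∑ w ∈ Z, ((W.count w : ℂ) - W.count (-w)) * w ^ (j + k) -
              ∑ w ∈ Z, ((W.count w : ℂ) - W.count (-w)) * w ^ j := by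
          rw [← Finset.sum_sub_distrib]
          exact Finset.sum_congr rfl fun w _ => by rw [pow_add]; ring
        rw [h3, h1, h2, pow_add, hk.neg_one_pow, mul_one]
        rcases Nat.even_or_odd j with hj | hj
        · rw [hj.neg_one_pow]; ring
        · rw [hper j hj, sub_self]) w hwZ
    have h1 := (mul_eq_zero.1 key).resolve_right (sub_ne_zero.2 hwk)
    exact_mod_cast (sub_eq_zero.1 h1).symm
  · have h1 : W.count w = 0 := Multiset.count_eq_zero.2 fun hw =>
      hwZ (hsub (Multiset.mem_toFinset.2 hw))
    have h2 : W.count (-w) = 0 := Multiset.count_eq_zero.2 fun hw => by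
      have := hneg _ (hsub (Multiset.mem_toFinset.2 hw))
      rw [neg_neg] at this
      exact hwZ this
    rw [h1, h2]

/-- The power sums of odd order, expressed by the asymmetries at the `ζ_{8ℓ}`, `ℓ ∣ k`, when the
asymmetry is supported on roots of unity of order dividing `8k`, `k` odd. -/
lemma IsTwistedStable.two_mul_sum_pow (h : IsTwistedStable P W) {k : ℕ} (hk : Odd k)
    (hsupp : ∀ w : ℂ, w ^ (8 * k) ≠ 1 → W.count (-w) = W.count w) {n : ℕ} (hn : Odd n) :
    2 * (W.map fun w => w ^ n).sum = ∑ l ∈ k.divisors,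
      2 * ((Real.sqrt 2 : ℝ) : ℂ) * (chi n * ramanujanSum l n * chi l) *
        ((W.count (zeta (8 * l)) : ℂ) - W.count (-zeta (8 * l))) := by
  have hk0 : k ≠ 0 := hk.pos.ne'
  have h8k : 8 * k ≠ 0 := by omega
  set D : ℂ → ℂ := fun w => (W.count w : ℂ) - W.count (-w) with hD
  have hDz : ∀ w : ℂ, w ^ (8 * k) ≠ 1 → D w = 0 := fun w hw => by
    rw [hD]; dsimp only; rw [hsupp w hw, sub_self]
  have hmem : ∀ {j : ℕ} (w : ℂ), j ≠ 0 → (w ∈ nthRootsFinset j (1 : ℂ) ↔ w ^ j = 1) :=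
    fun w hj => mem_nthRootsFinset (Nat.pos_of_ne_zero hj) _
  have hsum : ∑ w ∈ nthRootsFinset (8 * k) (1 : ℂ), D w * w ^ n =
      2 * (W.map fun w => w ^ n).sum := by
    have h8kP : 8 * k * P ≠ 0 := mul_ne_zero h8k h.ne_zero
    have h1 := sum_sub_count_neg (Z := nthRootsFinset (8 * k * P) (1 : ℂ)) (fun w hw => by
      rw [hmem w h8kP, mul_comm, pow_mul, h.pow_eq_one w (Multiset.mem_toFinset.1 hw), one_pow])
      (fun w hw => by
        rw [hmem _ h8kP] at hw ⊢
        rw [(h.even.mul_left _).neg_pow, hw]) n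
    rw [hn.neg_one_pow] at h1
    norm_num at h1
    rw [← h1]
    refine Finset.sum_subset (fun w hw => ?_) fun w _ hw => ?_
    · rw [hmem w h8k] at hw
      rw [hmem w h8kP, pow_mul, hw, one_pow]
    · rw [hmem w h8k] at hw
      rw [hDz w hw, zero_mul]
  rw [← hsum, sum_nthRootsFinset h8k]
  symm
  refine Finset.sum_of_injOn (fun l => 8 * l) (fun l _ l' _ hll => by simpa using hll) ?_ ?_ ?_
  · intro l hl
    rw [Finset.mem_coe, Nat.mem_divisors] at hl ⊢
    exact ⟨Nat.mul_dvd_mul_left 8 hl.1, h8k⟩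
  · intro l hl hl'
    obtain ⟨hlk, -⟩ := Nat.mem_divisors.1 hl
    have hl0 : l ≠ 0 := (Nat.pos_of_mem_divisors hl).ne'
    have h8 : ¬ 8 ∣ l := by
      rintro ⟨l', rfl⟩
      refine hl' ⟨l', ?_, rfl⟩
      rw [Finset.mem_coe, Nat.mem_divisors]
      exact ⟨Nat.dvd_of_mul_dvd_mul_left (by norm_num) hlk, hk0⟩
    refine Finset.sum_eq_zero fun i hi => ?_
    have := (h.count_zeta_pow_of_not_dvd hl0 h8 (mem_unitReps.1 hi).2).2
    rw [hD]; dsimp only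
    rw [this, sub_self, zero_mul]
  · intro l hl
    have hl0 : l ≠ 0 := (Nat.pos_of_mem_divisors hl).ne'
    have hlodd : Odd l := Odd.of_dvd_nat hk (Nat.dvd_of_mem_divisors hl)
    rw [← sum_chi_zeta_eight_mul hlodd hn, Finset.sum_mul]
    refine Finset.sum_congr rfl fun i hi => ?_
    obtain ⟨h1, h2⟩ := h.count_zeta_pow (by omega : 8 * l ≠ 0) (dvd_mul_right 8 l)
      (mem_unitReps.1 hi).2
    rw [hD]; dsimp only
    rw [← h1, ← h2, mul_comm n i, pow_mul]
    rcases chi_eq_or (odd_of_mem_unitReps (dvd_mul_right 8 l) hi) with hc | hc <;> rw [hc] <;>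
      push_cast <;> simp only [one_mul, neg_one_mul, neg_neg] <;> ring

end Negative

/-- At odd indices, the normalized sums have period `8N'`. -/
lemma expSumStar_add_eight_mul {F : Type*} [Field F] [Finite F] [CharP F 2]
    {m : ℕ} (hm : Odd m) (hF : Nat.card F = 2 ^ m) {d : ℕ}
    (hd : 1 ≤ d) {a : ℕ → F} (ha : a d ≠ 0) {s N' : ℕ} (hN : kernelDegree d a = 2 ^ s * N')
    {n : ℕ} (hn : Odd n) :
    expSumStar m (quadPoly d a) (n + 8 * N') = expSumStar m (quadPoly d a) n := by
  have hn' : Odd (n + 8 * N') := hn.add_even ⟨4 * N', by ring⟩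
  have h1 := chi_mul_expSumStar hm hF hd ha hN hn
  have h2 := chi_mul_expSumStar hm hF hd ha hN hn'
  rw [Nat.gcd_add_mul_right_left, ← h1, chi_add_mul_eight] at h2
  refine mul_left_cancel₀ ?_ h2
  rcases chi_eq_or hn with h | h <;> rw [h] <;> simp

end QuadAS

end

theorem mainTheorem7 {F : Type*} [Field F] [Finite F] [CharP F 2]
    (m : ℕ) (hm : Odd m) (hF : Nat.card F = 2 ^ m)
    (d : ℕ) (hd : 1 ≤ d) (a : ℕ → F) (ha : a d ≠ 0)
    (s N' : ℕ) (hN' : Odd N') (hN : QuadAS.kernelDegree d a = 2 ^ s * N') :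
    (∃ M : QuadAS.Multiplicities, QuadAS.IsMultiplicitiesOf m (QuadAS.quadPoly d a) M) ∧
    ∀ M : QuadAS.Multiplicities, QuadAS.IsMultiplicitiesOf m (QuadAS.quadPoly d a) M →
      (∀ l : ℕ, 1 ≤ l → padicValNat 2 l ≠ 3 → M.neg l = 0) ∧
      (∀ l : ℕ, 1 ≤ l → M.neg l ≠ 0 → ∃ l' : ℕ, l' ∣ N' ∧ l = 8 * l') ∧
      ((2 * ((Real.sqrt 2 : ℝ) : ℂ)) •
          (QuadAS.matDelta N' * QuadAS.matA N' * QuadAS.matDelta N')).mulVec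
          (fun l' : N'.divisors => ((M.neg (8 * l') : ℚ) : ℂ)) =
        fun n : N'.divisors => -QuadAS.expSumStar m (QuadAS.quadPoly d a) n := by
  classical
  obtain ⟨W, P, hL, hP, hP8, hW, hsum, hcount⟩ := QuadAS.exists_eigenvalues hm hF hd ha
  have hst : QuadAS.IsTwistedStable P W := ⟨hP, hP8, hW, hcount⟩
  constructor
  · obtain ⟨M, hM⟩ := hst.exists_multiplicities
    exact ⟨M, by rw [QuadAS.IsMultiplicitiesOf, M.toPoly_eq_linProd, hM, hL]⟩
  intro M hM
  -- Any system of multiplicities describes the same multiset of eigenvalues.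
  obtain rfl : W = M.toMultiset := by
    rw [QuadAS.IsMultiplicitiesOf, hL, M.toPoly_eq_linProd] at hM
    exact QuadAS.linProd_injective hst.zero_notMem M.zero_notMem_toMultiset
      (Polynomial.coe_injective ℂ hM)
  -- The sums of odd order have period `8N'`, which confines the asymmetry to orders dividing `8N'`.
  have hsupp : ∀ w : ℂ, w ^ (8 * N') ≠ 1 → M.toMultiset.count (-w) = M.toMultiset.count w :=
    fun w hw => hst.count_neg_eq_of_periodic (k := 8 * N') ⟨4 * N', by ring⟩ (fun n hn => by
      have h1 := hsum n hn.pos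
      have h2 := hsum (n + 8 * N') (by have := hn.pos; omega)
      rw [QuadAS.expSumStar_add_eight_mul hm hF hd ha hN hn, h1] at h2
      exact (neg_injective h2).symm) hw
  refine ⟨fun l hl hv => ?_, fun l hl hne => ?_, ?_⟩
  · have hl0 : l ≠ 0 := Nat.one_le_iff_ne_zero.1 hl
    rw [hst.neg_eq hl0]
    split_ifs with h8
    · have h3 : 3 ≤ padicValNat 2 l := by
        by_contra h
        exact (QuadAS.padicValNat_two_le_two_iff hl0).1 (by omega) h8
      have h16 : 16 ∣ l := (padicValNat_dvd_iff_le (p := 2) hl0 (n := 4)).2 (by omega)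
      rw [hst.count_neg_zeta hl0 h16, sub_self, zero_div]
    · rfl
  · have hl0 : l ≠ 0 := Nat.one_le_iff_ne_zero.1 hl
    rw [hst.neg_eq hl0] at hne
    split_ifs at hne with h8
    · obtain ⟨l', rfl⟩ := h8
      refine ⟨l', ?_, rfl⟩
      have h1 : QuadAS.zeta (8 * l') ^ (8 * N') = 1 := by
        by_contra h1
        rw [hsupp _ h1, sub_self, zero_div] at hne
        exact hne rfl
      exact Nat.dvd_of_mul_dvd_mul_left (by norm_num)
        ((QuadAS.zeta_isPrimitiveRoot hl0).dvd_of_pow_eq_one _ h1)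
    · exact absurd rfl hne
  · funext n
    have hn : Odd (n : ℕ) := Odd.of_dvd_nat hN' (Nat.dvd_of_mem_divisors n.2)
    have h1 := hst.two_mul_sum_pow hN' hsupp hn
    rw [hsum n hn.pos, neg_neg, Matrix.mulVec, dotProduct]
    have h2 : ∀ l : N'.divisors,
        ((2 * ((Real.sqrt 2 : ℝ) : ℂ)) •
          (QuadAS.matDelta N' * QuadAS.matA N' * QuadAS.matDelta N')) n l *
          ((M.neg (8 * l) : ℚ) : ℂ) =
        2⁻¹ * (2 * ((Real.sqrt 2 : ℝ) : ℂ) *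
          (QuadAS.chi n * QuadAS.ramanujanSum l n * QuadAS.chi l) *
          ((M.toMultiset.count (QuadAS.zeta (8 * l)) : ℂ) -
            M.toMultiset.count (-QuadAS.zeta (8 * l)))) := by
      intro l
      have hl0 : 8 * (l : ℕ) ≠ 0 := by
        have := Nat.pos_of_mem_divisors l.2
        omega
      rw [hst.neg_eq hl0, if_pos (dvd_mul_right 8 _), Matrix.smul_apply, QuadAS.matDelta,
        Matrix.mul_diagonal, Matrix.diagonal_mul, QuadAS.matA, Matrix.of_apply, smul_eq_mul]
      push_cast
      ring
    rw [Finset.sum_congr rfl fun l _ => h2 l, ← Finset.mul_sum,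
      Finset.sum_coe_sort N'.divisors (fun l => 2 * ((Real.sqrt 2 : ℝ) : ℂ) *
          (QuadAS.chi n * QuadAS.ramanujanSum l n * QuadAS.chi l) *
          ((M.toMultiset.count (QuadAS.zeta (8 * l)) : ℂ) -
            M.toMultiset.count (-QuadAS.zeta (8 * l)))), ← h1]
    ring
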